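/- **Setting.** Let $H_\varepsilon=H_0+\varepsilon H_1$ with $H_0(x,y)=\frac{y^2}{2}+V(x)$, where $V=V^+$ for $x\ge 0$, $V=V^-$ for $x<0$, and $H_1(x,y,t)=H_1^+$ for $x\ge0$, $H_1^-$ for $x<0$. Here $V^\pm$ and $H_1^\pm$ are $C^\infty$ on $\mathbb R$ and $\mathbb R^3$, $H_1^\pm$ is $T$-periodic in $t$ ($T>0$), $V^+(0)=V^-(0)$ and $H_1^+(0,y,t)=H_1^-(0,y,t)$. Consider the piecewise smooth system $(\dot x,\dot y)=(\partial_yH_\varepsilon,-\partial_xH_\varepsilon)$ in $x>0$ and in $x<0$. Assume that for $\varepsilon=0$: 1. there are two hyperbolic saddles $z^+$ (in $x>0$) and $z^-$ (in $x<0$) with $H_0(z^\pm)=c_1>0$; 2. the origin is an invisible fold-fold and $H_0(0,0)=0$; 3. there are two heteroclinic orbits in the level $H_0=c_1$, one from $z^-$ to $z^+$ and one from $z^+$ to $z^-$, which together with $z^\pm$ surround the origin; let $D$ be the region enclosed by them; 4. $D\setminus\{(0,0)\}$ is covered by the sets $\Lambda_c=\{H_0=c\}\cap D$, $0<c<c_1$,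 each of which is a periodic orbit that surrounds the origin and meets $x=0$ exactly twice, transversally; 5. the period of $\Lambda_c$ is a differentiable function of $c\in(0,c_1)$ with positive derivative. For $0<y<\sqrt{2c_1}$ put $h=y^2/2$ and $$\alpha(y)=2\int_0^{(V^+)^{-1}(h)}\frac{dx}{\sqrt{2(h-V^+(x))}}-2\int_0^{(V^-)^{-1}(h)}\frac{dx}{\sqrt{2(h-V^-(x))}},$$ where $(V^\pm)^{-1}(h)$ is the point between $0$ and $z^\pm$ at which $V^\pm=h$ (the first one on that side of $0$). Let $P_\varepsilon^+$ map $(y_0,t_0)$ with $0<y_0<\sqrt{2c_1}$ to $(y_1,t_1)$ with $-\sqrt{2c_1}<y_1<0$, where the trajectory of the field of $x>0$ starting at $(0,y_0)$ at time $t_0$ first returns to $x=0$, having stayed in $x>0$, at time $t_1>t_0$ and at the point $(0,y_1)$; let $P_\varepsilon^-$ be the analogous map in $x<0$, from $-\sqrt{2c_1}<y<0$ to $0<y<\sqrt{2c_1}$. These are partial maps. Let $R_r(y,t)=(ry,t)$, $P_\varepsilon=P_\varepsilon^-\circ P_\varepsilon^+$ and $\tilde P_{\varepsilon,r}=R_r\circ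 P_\varepsilon^-\circ R_r\circ P_\varepsilon^+$. **Theorem.** Let $n,m$ be relatively prime, $m\ge1$, let $0<\bar y_0<\sqrt{2c_1}$ satisfy $\alpha(\bar y_0)=\frac{nT}{m}$, and let $\bar t_0$ be a simple zero of $$M^{n,m}(t_0)=\int_0^{nT}\{H_0,H_1\}(q(t),t+t_0)\,dt,$$ where $q$ is the unperturbed orbit with $q(0)=(0,\bar y_0)$ and $\{Q,R\}=Q_xR_y-Q_yR_x$. Then there are $\rho>0$, a constant $K$, and functions $y_0^*(\varepsilon,r)$, $t_0^*(\varepsilon,r)$ such that the following holds. (a) For all $\tilde\varepsilon,\tilde r>0$ with $0<\tilde r/\tilde\varepsilon<\rho$ there are $\delta_0>0$, $C$ and $\hat t_0$ with $|\hat t_0-\bar t_0|\le K\,\tilde r/\tilde\varepsilon$ such that for every $0<\delta<\delta_0$, with $\varepsilon=\tilde\varepsilon\delta$ and $r=1-\tilde r\delta$, the point $(y_0^*,t_0^*)=(y_0^*(\varepsilon,r),t_0^*(\varepsilon,r))$ solves $$\tilde P_{\varepsilon,r}^m(y_0^*,t_0^*)=(y_0^*,t_0^*+nT),$$ and $|y_0^*-\bar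 y_0|\le C\delta$, $|t_0^*-\hat t_0|\le C\delta$. In particular $y_0^*=\bar y_0+O(\delta)$ and $t_0^*=\bar t_0+O(\delta)+O(\tilde r/\tilde\varepsilon)$. (b) There are $\varepsilon_0>0$ and, for $0<\varepsilon<\varepsilon_0$, conservative solutions $(y_c(\varepsilon),t_c(\varepsilon))=(\bar y_0,\bar t_0)+O(\varepsilon)$ of $P_\varepsilon^m(y,t)=(y,t+nT)$ such that, for each fixed $\varepsilon\in(0,\varepsilon_0)$, the point $(y_0^*(\varepsilon,r),t_0^*(\varepsilon,r))$ solves $\tilde P_{\varepsilon,r}^m(y,t)=(y,t+nT)$ for all $r<1$ close enough to $1$, and tends to $(y_c(\varepsilon),t_c(\varepsilon))$ as $r\to1^-$. -/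

import Mathlib

open Set Filter Topology
open scoped ContDiff

/-- A point `(x, y)` of the phase plane. -/
abbrev Plane : Type := ℝ × ℝ

/-- The planar Hamiltonian vector field `J ∇K = (∂K/∂y, -∂K/∂x)`. -/
noncomputable def hamField (K : ℝ → ℝ → ℝ) (z : Plane) : Plane :=
  (deriv (fun y => K z.1 y) z.2, -deriv (fun x => K x z.2) z.1)

/-- The Poisson bracket `{Q, R} = Q_x R_y - Q_y R_x`. -/
noncomputable def poissonBracket (Q R : ℝ → ℝ → ℝ) (z : Plane) : ℝ :=
  deriv (fun x => Q x z.2) z.1 * deriv (fun y => R z.1 y) z.2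
    - deriv (fun y => Q z.1 y) z.2 * deriv (fun x => R x z.2) z.1

/-- A hyperbolic critical point of saddle type of a planar vector field: the linearization has two
real eigenvalues of opposite signs, that is, negative determinant. -/
def IsHyperbolicSaddle (X : Plane → Plane) (z : Plane) : Prop :=
  X z = 0 ∧ LinearMap.det (fderiv ℝ X z : Plane →ₗ[ℝ] Plane) < 0

/-- The second Lie derivative at `z` of the function `(x, y) ↦ x` along the field `X`. -/
noncomputable def secondLieX (X : Plane → Plane) (z : Plane) : ℝ :=
  fderiv ℝ (fun w => (X w).1) z (X z)

/-- `z` is an invisible fold-fold of the pair `(Xp, Xm)` (`Xp` acting on `x > 0` and `Xm` on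
`x < 0`): both fields are tangent to the line `x = 0` at `z`, with quadratic tangency, and the
trajectory of each field through `z` stays on the side where that field does not act. -/
def IsInvisibleFoldFold (Xp Xm : Plane → Plane) (z : Plane) : Prop :=
  z.1 = 0 ∧ (Xp z).1 = 0 ∧ (Xm z).1 = 0 ∧ secondLieX Xp z < 0 ∧ 0 < secondLieX Xm z

/-- The set `A` surrounds the point `z`: `z` lies in a bounded component of the complement. -/
def Surrounds (A : Set Plane) (z : Plane) : Prop :=
  z ∉ A ∧ Bornology.IsBounded (connectedComponentIn Aᶜ z)

/-- The piecewise smooth Hamiltonian system with `H_ε = H₀ + ε H₁`, where `H₀ = y²/2 + V(x)`,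
`V = V⁺` for `x ≥ 0` and `V = V⁻` for `x < 0`, and similarly `H₁ = H₁^±(x, y, t)` is `T`-periodic
in `t`. Both Hamiltonians are continuous across the switching manifold `x = 0`. -/
structure PiecewiseHamiltonian where
  Vp : ℝ → ℝ
  Vm : ℝ → ℝ
  H1p : ℝ → ℝ → ℝ → ℝ
  H1m : ℝ → ℝ → ℝ → ℝ
  T : ℝ
  T_pos : 0 < T
  smooth_Vp : ContDiff ℝ ∞ Vp
  smooth_Vm : ContDiff ℝ ∞ Vm
  smooth_H1p : ContDiff ℝ ∞ (fun w : ℝ × ℝ × ℝ => H1p w.1 w.2.1 w.2.2)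
  smooth_H1m : ContDiff ℝ ∞ (fun w : ℝ × ℝ × ℝ => H1m w.1 w.2.1 w.2.2)
  V_match : Vp 0 = Vm 0
  H1_match : ∀ y t, H1p 0 y t = H1m 0 y t
  periodic_H1p : ∀ x y t, H1p x y (t + T) = H1p x y t
  periodic_H1m : ∀ x y t, H1m x y (t + T) = H1m x y t

namespace PiecewiseHamiltonian

variable (S : PiecewiseHamiltonian)

noncomputable def H0p (x y : ℝ) : ℝ := y ^ 2 / 2 + S.Vp x

noncomputable def H0m (x y : ℝ) : ℝ := y ^ 2 / 2 + S.Vm x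

/-- The unperturbed Hamiltonian. -/
noncomputable def H0 (z : Plane) : ℝ :=
  if 0 ≤ z.1 then S.H0p z.1 z.2 else S.H0m z.1 z.2

/-- The perturbed field of the half-plane `x > 0` at time `t`. -/
noncomputable def fieldP (ε t : ℝ) : Plane → Plane :=
  hamField (fun x y => S.H0p x y + ε * S.H1p x y t)

/-- The perturbed field of the half-plane `x < 0` at time `t`. -/
noncomputable def fieldM (ε t : ℝ) : Plane → Plane :=
  hamField (fun x y => S.H0m x y + ε * S.H1m x y t)

open Classical in
/-- The unperturbed piecewise smooth field. On the line `x = 0` the field followed forward in time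
is chosen according to the sign of `y`, since orbits twist clockwise. -/
noncomputable def field0 (z : Plane) : Plane :=
  if 0 < z.1 ∨ (z.1 = 0 ∧ 0 < z.2) then hamField S.H0p z else hamField S.H0m z

/-- `q` is a solution, defined for all times, of the unperturbed piecewise smooth system: the
continuous concatenation of solutions of the two smooth systems. -/
def IsSolution0 (q : ℝ → Plane) : Prop :=
  Continuous q ∧ ∀ t, HasDerivWithinAt q (S.field0 (q t)) (Ici t) t

/-- The set `A` is a (non-constant) periodic orbit of the unperturbed system, of least period
`p`. -/
def IsPeriodicOrbit0 (A : Set Plane) (p : ℝ) : Prop :=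
  ∃ q : ℝ → Plane, S.IsSolution0 q ∧ range q = A ∧
    IsLeast {s | 0 < s ∧ Function.Periodic q s} p

/-- `{H₀, H₁}` at `z` and time `t`, for the piecewise defined Hamiltonians. -/
noncomputable def bracketH0H1 (z : Plane) (t : ℝ) : ℝ :=
  if 0 ≤ z.1 then poissonBracket S.H0p (fun x y => S.H1p x y t) z
  else poissonBracket S.H0m (fun x y => S.H1m x y t) z

/-- The subharmonic Melnikov function `t₀ ↦ ∫₀^{nT} {H₀, H₁}(q(t), t + t₀) dt` of an unperturbed
orbit `q`. -/
noncomputable def melnikov (q : ℝ → Plane) (n : ℕ) (t₀ : ℝ) : ℝ :=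
  ∫ t in (0 : ℝ)..(n * S.T), S.bracketH0H1 (q t) (t + t₀)

/-- `(V⁺)⁻¹(h)`: the first point to the right of `0` where `V⁺` takes the value `h`. Under the
conditions on the phase portrait `V⁺` is increasing from `0` to the saddle, and this is its
inverse there. -/
noncomputable def invVp (h : ℝ) : ℝ := sInf {x | 0 < x ∧ S.Vp x = h}

/-- `(V⁻)⁻¹(h)`: the first point to the left of `0` where `V⁻` takes the value `h`. -/
noncomputable def invVm (h : ℝ) : ℝ := sSup {x | x < 0 ∧ S.Vm x = h}

/-- `α⁺(y)`, the time that the unperturbed orbit of `(0, y)`, `y > 0`, spends in `x > 0`. -/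
noncomputable def alphaP (y : ℝ) : ℝ :=
  2 * ∫ x in (0 : ℝ)..(S.invVp (y ^ 2 / 2)), 1 / √(2 * (y ^ 2 / 2 - S.Vp x))

/-- `α⁻(y)`, the time that the unperturbed orbit of `(0, y)`, `y < 0`, spends in `x < 0`. -/
noncomputable def alphaM (y : ℝ) : ℝ :=
  -2 * ∫ x in (0 : ℝ)..(S.invVm (y ^ 2 / 2)), 1 / √(2 * (y ^ 2 / 2 - S.Vm x))

/-- `α(y) = α⁺(y) + α⁻(-y)`. -/
noncomputable def alpha (y : ℝ) : ℝ := S.alphaP y + S.alphaM (-y)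

/-- Candidate saddles `zp`, `zm`, connecting orbits `γ₁` (from `zm` to `zp`) and `γ₂` (from `zp` to
`zm`) and their energy `c₁`; the conditions on them are in `PhasePortrait.Conditions`. -/
structure PhasePortrait where
  c₁ : ℝ
  zp : Plane
  zm : Plane
  γ₁ : ℝ → Plane
  γ₂ : ℝ → Plane

namespace PhasePortrait

variable (Φ : PhasePortrait)

/-- The closed curve formed by the two heteroclinic orbits and the two saddles. -/
def cycle : Set Plane := range Φ.γ₁ ∪ range Φ.γ₂ ∪ {Φ.zp, Φ.zm}

/-- The region enclosed by the heteroclinic orbits: the component of the origin in the complement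
of the closed curve that they form. -/
def region : Set Plane := connectedComponentIn Φ.cycleᶜ (0, 0)

/-- `Λ_c`: the part of the energy level `H₀ = c` in the region enclosed by the heteroclinic
orbits. -/
def Lam (c : ℝ) : Set Plane := {z ∈ Φ.region | S.H0 z = c}

/-- The hypotheses on the phase portrait of the unperturbed system: two saddles at energy `c₁ > 0`,
an invisible fold-fold at the origin, two heteroclinic orbits between the saddles that together
surround the origin, and, covering the region that they enclose, periodic orbits `Λ_c`,
`0 < c < c₁`, around the origin, whose period is a differentiable function of `c` with positive
derivative. -/
structure Conditions : Prop where
  c₁_pos : 0 < Φ.c₁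
  zp_pos : 0 < Φ.zp.1
  zm_neg : Φ.zm.1 < 0
  saddle_zp : IsHyperbolicSaddle (hamField S.H0p) Φ.zp
  saddle_zm : IsHyperbolicSaddle (hamField S.H0m) Φ.zm
  H0_zp : S.H0 Φ.zp = Φ.c₁
  H0_zm : S.H0 Φ.zm = Φ.c₁
  foldFold : IsInvisibleFoldFold (hamField S.H0p) (hamField S.H0m) (0, 0)
  H0_origin : S.H0 (0, 0) = 0
  solution_γ₁ : S.IsSolution0 Φ.γ₁
  γ₁_atBot : Tendsto Φ.γ₁ atBot (𝓝 Φ.zm)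
  γ₁_atTop : Tendsto Φ.γ₁ atTop (𝓝 Φ.zp)
  H0_γ₁ : ∀ t, S.H0 (Φ.γ₁ t) = Φ.c₁
  solution_γ₂ : S.IsSolution0 Φ.γ₂
  γ₂_atBot : Tendsto Φ.γ₂ atBot (𝓝 Φ.zp)
  γ₂_atTop : Tendsto Φ.γ₂ atTop (𝓝 Φ.zm)
  H0_γ₂ : ∀ t, S.H0 (Φ.γ₂ t) = Φ.c₁
  cycle_surrounds : Surrounds Φ.cycle (0, 0)
  region_covered : ∀ z ∈ Φ.region, z ≠ (0, 0) → ∃ c ∈ Ioo 0 Φ.c₁, z ∈ Lam S Φ c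
  Lam_surrounds : ∀ c ∈ Ioo 0 Φ.c₁, Surrounds (Lam S Φ c) (0, 0)
  Lam_crosses_twice : ∀ c ∈ Ioo 0 Φ.c₁, {z ∈ Lam S Φ c | z.1 = 0}.ncard = 2
  Lam_transversal : ∀ c ∈ Ioo 0 Φ.c₁, ∀ z ∈ Lam S Φ c, z.1 = 0 →
    (hamField S.H0p z).1 ≠ 0 ∧ (hamField S.H0m z).1 ≠ 0
  Lam_periodic : ∃ τ : ℝ → ℝ, ∀ c ∈ Ioo 0 Φ.c₁,
    S.IsPeriodicOrbit0 (Lam S Φ c) (τ c) ∧ 0 < deriv τ c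

/-- Velocities and times `(y, t)` on the Poincaré section `x = 0`, `0 < y < √(2 c₁)`. -/
def sectionP : Set (ℝ × ℝ) := {p | 0 < p.1 ∧ p.1 < √(2 * Φ.c₁)}

/-- Velocities and times `(y, t)` on the Poincaré section `x = 0`, `-√(2 c₁) < y < 0`. -/
def sectionM : Set (ℝ × ℝ) := {p | -√(2 * Φ.c₁) < p.1 ∧ p.1 < 0}

/-- The graph of the partial map `P⁺_ε`: the trajectory of the field of `x > 0` that leaves
`(0, y)` at time `t` stays in `x > 0` until it comes back to the line `x = 0`, for the first time,
at the point `(0, y')` at time `t'`; here `p = (y, t)`, `p' = (y', t')`. -/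
def ImpactP (ε : ℝ) (p p' : ℝ × ℝ) : Prop :=
  p ∈ Φ.sectionP ∧ p' ∈ Φ.sectionM ∧ p.2 < p'.2 ∧
    ∃ z : ℝ → Plane, z p.2 = (0, p.1) ∧ z p'.2 = (0, p'.1) ∧
      (∀ t ∈ Ioo p.2 p'.2, 0 < (z t).1) ∧
      ∀ t ∈ Icc p.2 p'.2, HasDerivWithinAt z (S.fieldP ε t (z t)) (Icc p.2 p'.2) t

/-- The graph of the partial map `P⁻_ε`, defined in the same way in `x < 0`. -/
def ImpactM (ε : ℝ) (p p' : ℝ × ℝ) : Prop :=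
  p ∈ Φ.sectionM ∧ p' ∈ Φ.sectionP ∧ p.2 < p'.2 ∧
    ∃ z : ℝ → Plane, z p.2 = (0, p.1) ∧ z p'.2 = (0, p'.1) ∧
      (∀ t ∈ Ioo p.2 p'.2, (z t).1 < 0) ∧
      ∀ t ∈ Icc p.2 p'.2, HasDerivWithinAt z (S.fieldM ε t (z t)) (Icc p.2 p'.2) t

/-- The instantaneous loss of velocity at an impact, `R_r (y, t) = (r y, t)`. -/
def restitution (r : ℝ) (p : ℝ × ℝ) : ℝ × ℝ := (r * p.1, p.2)

/-- The graph of the conservative impact map `P_ε = P⁻_ε ∘ P⁺_ε`. -/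
def ImpactMap (ε : ℝ) (p p' : ℝ × ℝ) : Prop :=
  ∃ a, ImpactP S Φ ε p a ∧ ImpactM S Φ ε a p'

/-- The graph of the dissipative impact map `R_r ∘ P⁻_ε ∘ R_r ∘ P⁺_ε`. -/
def DissipativeImpactMap (ε r : ℝ) (p p' : ℝ × ℝ) : Prop :=
  ∃ a b, ImpactP S Φ ε p a ∧ ImpactM S Φ ε (restitution r a) b ∧ p' = restitution r b

end PhasePortrait

/-- The graph of the `m`-th iterate of the partial map with graph `R`. -/
def iterateGraph (R : ℝ × ℝ → ℝ × ℝ → Prop) : ℕ → ℝ × ℝ → ℝ × ℝ → Prop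
  | 0, p, p' => p' = p
  | m + 1, p, p' => ∃ a, iterateGraph R m p a ∧ R a p'

/-- `p = (y, t)` solves the conservative `(n, m)`-periodic orbit equation
`P_ε^m (y, t) = (y, t + n T)`. -/
def SolvesConservative (Φ : PhasePortrait) (n m : ℕ) (ε : ℝ) (p : ℝ × ℝ) : Prop :=
  iterateGraph (PhasePortrait.ImpactMap S Φ ε) m p (p.1, p.2 + n * S.T)

/-- `p = (y, t)` solves the dissipative `(n, m)`-periodic orbit equation: the `m`-th iterate of the
dissipative impact map sends `(y, t)` to `(y, t + n T)`. -/
def SolvesDissipative (Φ : PhasePortrait) (n m : ℕ) (ε r : ℝ) (p : ℝ × ℝ) : Prop :=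
  iterateGraph (PhasePortrait.DissipativeImpactMap S Φ ε r) m p (p.1, p.2 + n * S.T)

end PiecewiseHamiltonian

/-! Everything rests on an exact energy balance at the section `x = 0`. Along a perturbed arc, `y²/2
+ V` changes by `ε` times the integral of `{H₀, H₁}`, the work of the perturbation; an impact
multiplies the kinetic energy by `r²`. Hence after `m` turns `y'²/2 = y²/2 + ε A + (1 - r) B`, where
`A` is the total work and `B` collects the impact losses, both being regular functions of `(y, t, ε,
1 - r)`.

Put `1 - r = ε κ`. For `ε ≠ 0` and positive velocities, the condition `y' = y` is `A + κ B = 0`,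
which makes sense at `ε = 0` too. Together with the time equation `t' = t + nT` it forms a system of
two equations in `(y, t)` with parameters `(ε, κ)`. At `ε = κ = 0` the time equation reads `m
τ(y²/2) = nT`, with `τ` the period as a function of energy, and the other one, on `y = ȳ₀`, is the
Melnikov function. The Jacobian is therefore triangular, with diagonal `m ȳ₀ τ'(ȳ₀²/2)` and
`M'(t̄₀)`, both nonzero. The implicit function theorem gives a branch `ψ(ε, κ)` (`exists_branch`).

The two parts of the theorem are two ways of approaching the axes of the `(ε, κ)` plane. With `κ =
r̃/ε̃` fixed and `ε → 0`, the branch tends to `ψ(0, κ)`; the time equation at `ε = 0` still forces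
`y = ȳ₀`, while the phase `t̂₀` is only `O(κ)`-close to `t̄₀`. With `ε` fixed and `κ → 0` it tends
to the conservative orbit `ψ(ε, 0)`. Strict differentiability of `ψ` makes it Lipschitz near the
origin, which yields all the estimates.

What remains is regularity of the impact map and of `A`. The work is carried as an extra coordinate
of the flow, so `A` never arises from a division by `ε`. Flow dependence comes from the implicit
function theorem in `C([0, 1])`, using `hasStrictFDerivAt_superposition` and
`exists_inverse_one_sub_volterra`; the return time comes from a further implicit function argument
at a transversal crossing (`exists_arcMap_hasStrictFDerivAt`). Finally `two_mul_integral_eq_time`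
and `exists_period` identify `α` with `τ`. -/

/-! ### Superposition operators -/

section Superposition

variable {X E F : Type*} [TopologicalSpace X] [CompactSpace X]
  [NormedAddCommGroup E] [NormedSpace ℝ E] [NormedAddCommGroup F] [NormedSpace ℝ F]

/-- Pointwise application of a continuous family of operators to a continuous function. -/
noncomputable def pointwiseApply (A : C(X, E →L[ℝ] F)) : C(X, E) →L[ℝ] C(X, F) :=
  LinearMap.mkContinuous
    { toFun := fun v => ⟨fun s => A s (v s), by fun_prop⟩
      map_add' := fun u v => by ext s; simp
      map_smul' := fun c v => by ext s; simp }
    ‖A‖ (fun v => by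
      refine (ContinuousMap.norm_le _ (by positivity)).2 fun s => ?_
      exact ((A s).le_opNorm _).trans (mul_le_mul (A.norm_coe_le_norm s) (v.norm_coe_le_norm s)
        (norm_nonneg _) ((norm_nonneg _).trans (A.norm_coe_le_norm s))))

@[simp] lemma pointwiseApply_apply (A : C(X, E →L[ℝ] F)) (v : C(X, E)) (s : X) :
    pointwiseApply A v s = A s (v s) := rfl

/-- The superposition operator `u ↦ f ∘ u` of a `C¹` map is strictly differentiable. -/
theorem hasStrictFDerivAt_superposition {f : E → F} (hf : ContDiff ℝ 1 f) (u₀ : C(X, E)) :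
    HasStrictFDerivAt (fun u : C(X, E) => (⟨f, hf.continuous⟩ : C(E, F)).comp u)
      (pointwiseApply
        ((⟨fderiv ℝ f, hf.continuous_fderiv one_ne_zero⟩ : C(E, E →L[ℝ] F)).comp u₀)) u₀ := by
  rw [hasStrictFDerivAt_iff_isLittleO, Asymptotics.isLittleO_iff]
  intro c hc
  have hcont : Continuous (fderiv ℝ f) := hf.continuous_fderiv one_ne_zero
  have hK : IsCompact (range u₀) := isCompact_range u₀.continuous
  -- Compactness of the range of `u₀` gives one `δ` for all `s`, so the pointwise mean value
  -- inequality below is uniform in `s`.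
  have hunif := hK.uniformContinuousAt_of_continuousAt (fderiv ℝ f)
    (fun a _ => hcont.continuousAt) (Metric.dist_mem_uniformity hc)
  obtain ⟨δ, hδ, hδs⟩ := Metric.mem_uniformity_dist.1 hunif
  have hball : ∀ᶠ p : C(X, E) × C(X, E) in 𝓝 (u₀, u₀), dist p.1 u₀ < δ ∧ dist p.2 u₀ < δ := by
    rw [nhds_prod_eq]
    exact prod_mem_prod (Metric.ball_mem_nhds u₀ hδ) (Metric.ball_mem_nhds u₀ hδ)
  filter_upwards [hball] with p hp
  refine (ContinuousMap.norm_le _ (by positivity)).2 fun s => ?_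
  have h1 : p.1 s ∈ Metric.ball (u₀ s) δ :=
    (ContinuousMap.dist_apply_le_dist s).trans_lt hp.1
  have h2 : p.2 s ∈ Metric.ball (u₀ s) δ :=
    (ContinuousMap.dist_apply_le_dist s).trans_lt hp.2
  have := (convex_ball (u₀ s) δ).norm_image_sub_le_of_norm_hasFDerivWithin_le'
    (f := f) (f' := fderiv ℝ f) (C := c) (φ := fderiv ℝ f (u₀ s))
    (fun x _ => ((hf.differentiable one_ne_zero) x).hasFDerivAt.hasFDerivWithinAt)
    (fun x hx => by
      have hx' : dist (u₀ s) x < δ := by rw [dist_comm]; exact hx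
      have : dist (fderiv ℝ f (u₀ s)) (fderiv ℝ f x) < c := hδs hx' ⟨s, rfl⟩
      rw [dist_comm, dist_eq_norm] at this
      exact this.le) h2 h1
  refine this.trans (mul_le_mul_of_nonneg_left ?_ hc.le)
  exact (p.1 - p.2).norm_coe_le_norm s

end Superposition

/-! ### Volterra operators -/

section Volterra

/-- `1 - K` is invertible if a power of `K` has norm less than `1`. -/
lemma exists_inverse_one_sub_of_norm_pow_lt_one {F : Type*} [NormedAddCommGroup F]
    [NormedSpace ℝ F] [CompleteSpace F] (K : F →L[ℝ] F) (n : ℕ) (hKn : ‖K ^ n‖ < 1) :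
    ∃ T : F →L[ℝ] F, (∀ u, T u - K (T u) = u) ∧ ∀ u, T (u - K u) = u := by
  have h := isUnit_one_sub_of_norm_lt_one hKn
  -- `1 - K ^ n` is the product of `1 - K` with a geometric sum that commutes with it, and commuting
  -- factors of a unit are units.
  rw [← mul_neg_geom_sum] at h
  have hc : Commute (1 - K) (∑ i ∈ Finset.range n, K ^ i) := by
    rw [Commute, SemiconjBy, mul_neg_geom_sum, geom_sum_mul_neg]
  obtain ⟨u, hu⟩ := (hc.isUnit_mul_iff.1 h).1
  refine ⟨(↑u⁻¹ : F →L[ℝ] F), fun x => ?_, fun x => ?_⟩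
  · have := DFunLike.congr_fun u.mul_inv x
    rw [hu] at this
    exact this
  · have := DFunLike.congr_fun u.inv_mul x
    rw [hu] at this
    exact this

variable {E : Type*} [NormedAddCommGroup E] [NormedSpace ℝ E]

/-- Continuous extension of a curve on `[0, 1]` to the line. -/
noncomputable def curveExtend {E : Type*} [NormedAddCommGroup E] (u : C(unitInterval, E)) : ℝ → E :=
  fun s => u (projIcc 0 1 zero_le_one s)

lemma continuous_curveExtend {E : Type*} [NormedAddCommGroup E] (u : C(unitInterval, E)) :
    Continuous (curveExtend u) :=
  u.continuous.comp continuous_projIcc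

lemma curveExtend_of_mem {E : Type*} [NormedAddCommGroup E] (u : C(unitInterval, E)) {s : ℝ} (hs : s ∈ Icc (0 : ℝ) 1) :
    curveExtend u s = u ⟨s, hs⟩ := by
  simp [curveExtend, projIcc_of_mem _ hs]

lemma norm_curveExtend_le {E : Type*} [NormedAddCommGroup E] (u : C(unitInterval, E)) (s : ℝ) : ‖curveExtend u s‖ ≤ ‖u‖ :=
  u.norm_coe_le_norm _

/-- The primitive vanishing at `0` of a continuous curve on `[0, 1]`. -/
noncomputable def primitive : C(unitInterval, E) →L[ℝ] C(unitInterval, E) :=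
  LinearMap.mkContinuous
    { toFun := fun u => ⟨fun s => ∫ σ in (0 : ℝ)..s, curveExtend u σ,
        (intervalIntegral.continuous_primitive
          (fun a b => (continuous_curveExtend u).intervalIntegrable a b) 0).comp
          continuous_subtype_val⟩
      map_add' := fun u v => by
        ext s
        exact intervalIntegral.integral_add ((continuous_curveExtend u).intervalIntegrable _ _)
          ((continuous_curveExtend v).intervalIntegrable _ _)
      map_smul' := fun c v => by
        ext s
        exact intervalIntegral.integral_smul c _ }
    1 (fun u => by
      refine (ContinuousMap.norm_le _ (by positivity)).2 fun s => ?_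
      have := intervalIntegral.norm_integral_le_of_norm_le_const (a := 0) (b := (s : ℝ))
        (f := curveExtend u) (C := ‖u‖) (fun x _ => norm_curveExtend_le u x)
      refine this.trans ?_
      rw [sub_zero, abs_of_nonneg s.2.1, mul_comm]
      exact mul_le_mul_of_nonneg_right s.2.2 (norm_nonneg _))

lemma primitive_apply (u : C(unitInterval, E)) (s : unitInterval) :
    primitive u s = ∫ σ in (0 : ℝ)..s, curveExtend u σ := rfl

/-- The bound must keep its dependence on `s`: integrating `σ ^ n` gains the factor `1 / (n + 1)` at
each step of the induction, and these factors build the factorial. -/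
lemma norm_volterra_pow_apply_le (A : C(unitInterval, E →L[ℝ] E)) (u : C(unitInterval, E)) (n : ℕ)
    (s : unitInterval) :
    ‖((primitive ∘L pointwiseApply A) ^ n) u s‖ ≤ (‖A‖ * s) ^ n / n.factorial * ‖u‖ := by
  induction n generalizing s with
  | zero => simpa using u.norm_coe_le_norm s
  | succ n ih =>
    rw [pow_succ']
    set w := ((primitive ∘L pointwiseApply A) ^ n) u with hw
    change ‖∫ σ in (0 : ℝ)..s, curveExtend (pointwiseApply A w) σ‖ ≤ _
    have hbound : ∀ σ ∈ Ioc (0 : ℝ) s, ‖curveExtend (pointwiseApply A w) σ‖ ≤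
        (‖A‖ ^ (n + 1) / n.factorial * ‖u‖) * σ ^ n := by
      intro σ hσ
      have hσ' : σ ∈ Icc (0 : ℝ) 1 := ⟨hσ.1.le, hσ.2.trans s.2.2⟩
      rw [curveExtend_of_mem _ hσ', pointwiseApply_apply]
      refine ((A _).le_opNorm _).trans ?_
      have := mul_le_mul (A.norm_coe_le_norm ⟨σ, hσ'⟩) (ih ⟨σ, hσ'⟩) (norm_nonneg _)
        (norm_nonneg _)
      refine this.trans (le_of_eq ?_)
      simp only
      rw [mul_pow, pow_succ]
      ring
    have := intervalIntegral.norm_integral_le_of_norm_le (μ := MeasureTheory.volume) s.2.1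
      (Eventually.of_forall hbound) (by
        apply Continuous.intervalIntegrable; fun_prop)
    refine this.trans (le_of_eq ?_)
    rw [intervalIntegral.integral_const_mul, integral_pow, Nat.factorial_succ]
    push_cast
    have : (n.factorial : ℝ) ≠ 0 := by positivity
    field_simp
    ring

/-- The factorial beats `‖A‖ ^ n` whatever the size of `A`, so the linearized integral equation is
solvable on the whole of `[0, 1]` and no gluing of short time intervals is needed. -/
lemma exists_inverse_one_sub_volterra [CompleteSpace E] (A : C(unitInterval, E →L[ℝ] E)) :
    ∃ T : C(unitInterval, E) →L[ℝ] C(unitInterval, E),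
      (∀ u, T u - primitive (pointwiseApply A (T u)) = u) ∧
      ∀ u, T (u - primitive (pointwiseApply A u)) = u := by
  have hA : 0 ≤ ‖A‖ := (norm_nonneg _).trans (A.norm_coe_le_norm 0)
  set K : C(unitInterval, E) →L[ℝ] C(unitInterval, E) := primitive ∘L pointwiseApply A with hK
  obtain ⟨n, hn⟩ : ∃ n : ℕ, ‖A‖ ^ n / n.factorial < 1 / 2 :=
    ((FloorSemiring.tendsto_pow_div_factorial_atTop ‖A‖).eventually
      (gt_mem_nhds (by norm_num))).exists
  have hKn : ‖K ^ n‖ < 1 := by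
    refine lt_of_le_of_lt (ContinuousLinearMap.opNorm_le_bound _ (by positivity) fun u => ?_)
      (hn.trans (by norm_num))
    refine (ContinuousMap.norm_le _ (by positivity)).2 fun s => ?_
    refine (norm_volterra_pow_apply_le A u n s).trans ?_
    have hs : ‖A‖ * s ≤ ‖A‖ := mul_le_of_le_one_right hA s.2.2
    have hs0 : 0 ≤ ‖A‖ * s := mul_nonneg hA s.2.1
    gcongr
  exact exists_inverse_one_sub_of_norm_pow_lt_one K n hKn

end Volterra

/-! ### Dependence of the flow on the initial value -/

section Flow

variable {E : Type*} [NormedAddCommGroup E] [NormedSpace ℝ E] [CompleteSpace E]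

lemma hasDerivWithinAt_curveExtend_of_eq_integral {u : C(unitInterval, E)} {p : E} {g : ℝ → E}
    (hg : Continuous g) (h : ∀ s : unitInterval, u s = p + ∫ σ in (0 : ℝ)..s, g σ) :
    ∀ s ∈ Icc (0 : ℝ) 1, HasDerivWithinAt (curveExtend u) (g s) (Icc 0 1) s := by
  intro s hs
  have h1 : HasDerivAt (fun t => p + ∫ σ in (0 : ℝ)..t, g σ) (g s) s :=
    (intervalIntegral.integral_hasDerivAt_right (hg.intervalIntegrable _ _)
      (hg.stronglyMeasurableAtFilter _ _) hg.continuousAt).const_add p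
  refine h1.hasDerivWithinAt.congr (fun t ht => ?_) ?_
  · rw [curveExtend_of_mem u ht, h]
  · rw [curveExtend_of_mem u hs, h]

/-- Strictly differentiable dependence of the solutions of `u' = X(u)` on `[0, 1]` on the initial
value, near a given solution. -/
theorem exists_flow_hasStrictFDerivAt {X : E → E} (hX : ContDiff ℝ 1 X) {γ : ℝ → E}
    (hγ : ∀ s ∈ Icc (0 : ℝ) 1, HasDerivWithinAt γ (X (γ s)) (Icc 0 1) s) :
    ∃ (Ψ : E → C(unitInterval, E)) (L : E →L[ℝ] C(unitInterval, E)),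
      HasStrictFDerivAt Ψ L (γ 0) ∧ (∀ s : unitInterval, Ψ (γ 0) s = γ s) ∧
      ∀ᶠ p in 𝓝 (γ 0), curveExtend (Ψ p) 0 = p ∧ ∀ s ∈ Icc (0 : ℝ) 1,
        HasDerivWithinAt (curveExtend (Ψ p)) (X (curveExtend (Ψ p) s)) (Icc 0 1) s := by
  have hγc : ContinuousOn γ (Icc 0 1) := fun s hs => (hγ s hs).continuousWithinAt
  set u₀ : C(unitInterval, E) := ⟨fun s => γ s, hγc.comp_continuous continuous_subtype_val
    (fun s => s.2)⟩ with hu₀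
  set N : C(unitInterval, E) → C(unitInterval, E) :=
    fun u => (⟨X, hX.continuous⟩ : C(E, E)).comp u with hN
  set A : C(unitInterval, E →L[ℝ] E) :=
    (⟨fderiv ℝ X, hX.continuous_fderiv one_ne_zero⟩ : C(E, E →L[ℝ] E)).comp u₀ with hA
  have hNd : HasStrictFDerivAt N (pointwiseApply A) u₀ := hasStrictFDerivAt_superposition hX u₀
  let κ : E →L[ℝ] C(unitInterval, E) := LinearMap.mkContinuous
    { toFun := fun p => ContinuousMap.const _ p
      map_add' := fun _ _ => rfl
      map_smul' := fun _ _ => rfl } 1 (fun p => by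
        refine (ContinuousMap.norm_le _ (by positivity)).2 fun s => ?_
        rw [one_mul]
        exact le_refl ‖p‖)
  have hκ : ∀ p s, κ p s = p := fun _ _ => rfl
  have hκ0 : κ 0 = 0 := map_zero κ
  -- The unknown is the whole curve: zeros of `G` are the solutions of the integral equation
  -- starting at `q.1`. The partial derivative of `G` in the curve is the identity minus a Volterra
  -- operator.
  set G : E × C(unitInterval, E) → C(unitInterval, E) :=
    fun q => q.2 - κ q.1 - primitive (N q.2) with hG
  have hGd : HasStrictFDerivAt G
      (ContinuousLinearMap.snd ℝ E C(unitInterval, E) - κ ∘L ContinuousLinearMap.fst ℝ _ _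
        - primitive ∘L (pointwiseApply A) ∘L ContinuousLinearMap.snd ℝ _ _) (γ 0, u₀) := by
    refine (hasStrictFDerivAt_snd.sub (κ.hasStrictFDerivAt.comp _ hasStrictFDerivAt_fst)).sub ?_
    exact primitive.hasStrictFDerivAt.comp _
      (HasStrictFDerivAt.comp (g := N) (γ 0, u₀) hNd hasStrictFDerivAt_snd)
  have hinv : ((ContinuousLinearMap.snd ℝ E C(unitInterval, E)
      - κ ∘L ContinuousLinearMap.fst ℝ _ _
      - primitive ∘L (pointwiseApply A) ∘L ContinuousLinearMap.snd ℝ _ _) ∘L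
        ContinuousLinearMap.inr ℝ E C(unitInterval, E)).IsInvertible := by
    obtain ⟨R, hR1, hR2⟩ := exists_inverse_one_sub_volterra A
    refine ContinuousLinearMap.IsInvertible.of_inverse (g := R) ?_ ?_
    · refine ContinuousLinearMap.ext fun u => ?_
      simpa [hκ0] using hR1 u
    · refine ContinuousLinearMap.ext fun u => ?_
      simpa [hκ0] using hR2 u
  have hint : ∀ t ∈ Icc (0 : ℝ) 1, γ t = γ 0 + ∫ σ in (0 : ℝ)..t, curveExtend (N u₀) σ := by
    intro t ht
    have hsub : Icc 0 t ⊆ Icc (0 : ℝ) 1 := Icc_subset_Icc_right ht.2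
    rw [intervalIntegral.integral_eq_sub_of_hasDeriv_right_of_le ht.1 (hγc.mono hsub) (fun s hs => ?_)
      ((continuous_curveExtend _).intervalIntegrable _ _), add_sub_cancel]
    have hs1 : s ∈ Icc (0 : ℝ) 1 := hsub (Ioo_subset_Icc_self hs)
    have := (hγ s hs1).hasDerivAt (Icc_mem_nhds hs.1 (hs.2.trans_le ht.2))
    rw [curveExtend_of_mem _ hs1]
    exact this.hasDerivWithinAt
  have hzero : G (γ 0, u₀) = 0 := by
    ext s
    simp only [hG, ContinuousMap.sub_apply, ContinuousMap.zero_apply, hκ, primitive_apply]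
    have := hint s s.2
    rw [← sub_eq_iff_eq_add', ← sub_eq_zero] at this
    exact this
  refine ⟨hGd.implicitFunctionOfProdDomain hinv, _,
    hGd.hasStrictFDerivAt_implicitFunctionOfProdDomain hinv, fun s => ?_, ?_⟩
  · have := (hGd.eventually_apply_eq_iff_implicitFunctionOfProdDomain hinv).self_of_nhds.1 rfl
    simp only at this
    rw [this]
    rfl
  · filter_upwards [hGd.eventually_apply_implicitFunctionOfProdDomain hinv] with p hp
    set u := hGd.implicitFunctionOfProdDomain hinv p with hu
    rw [hzero] at hp
    have hp' : ∀ s : unitInterval, u s = p + ∫ σ in (0 : ℝ)..s, curveExtend (N u) σ := by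
      intro s
      have := DFunLike.congr_fun hp s
      simp only [hG, ContinuousMap.sub_apply, ContinuousMap.zero_apply, hκ, primitive_apply] at this
      rw [← sub_eq_iff_eq_add', ← sub_eq_zero]
      exact this
    refine ⟨?_, hasDerivWithinAt_curveExtend_of_eq_integral (continuous_curveExtend (N u)) hp'⟩
    rw [curveExtend_of_mem u (by simp), hp']
    simp

/-- Forward uniqueness for an autonomous `C¹` field. -/
theorem eqOn_Icc_of_hasDerivWithinAt_Ici {E : Type*} [NormedAddCommGroup E] [NormedSpace ℝ E]
    {X : E → E} (hX : ContDiff ℝ 1 X) {f g : ℝ → E}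
    {a b : ℝ} (hf : ContinuousOn f (Icc a b)) (hg : ContinuousOn g (Icc a b))
    (hf' : ∀ t ∈ Ico a b, HasDerivWithinAt f (X (f t)) (Ici t) t)
    (hg' : ∀ t ∈ Ico a b, HasDerivWithinAt g (X (g t)) (Ici t) t) (h : f a = g a) :
    EqOn f g (Icc a b) := by
  have hK : IsCompact (f '' Icc a b ∪ g '' Icc a b) :=
    (isCompact_Icc.image_of_continuousOn hf).union (isCompact_Icc.image_of_continuousOn hg)
  obtain ⟨K, hL⟩ := (hX.locallyLipschitz.locallyLipschitzOn).exists_lipschitzOnWith_of_compact hK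
  exact ODE_solution_unique_of_mem_Icc_right (v := fun _ => X) (fun _ _ => hL) hf hf'
    (fun t ht => Or.inl ⟨t, Ico_subset_Icc_self ht, rfl⟩) hg hg'
    (fun t ht => Or.inr ⟨t, Ico_subset_Icc_self ht, rfl⟩) h

end Flow

/-! ### Persistence of positivity between two transversal zeros -/

/-- A function on `[0, 1]` that vanishes at the ends and is `C¹`-close to a function which is
positive inside and has nonzero slopes at the ends is positive inside. -/
theorem eventually_pos_of_near (x₀ d₀ : C(unitInterval, ℝ))
    (hpos : ∀ s ∈ Ioo (0 : ℝ) 1, 0 < curveExtend x₀ s)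
    (h0 : 0 < curveExtend d₀ 0) (h1 : curveExtend d₀ 1 < 0) :
    ∀ᶠ q : C(unitInterval, ℝ) × C(unitInterval, ℝ) in 𝓝 (x₀, d₀),
      curveExtend q.1 0 = 0 → curveExtend q.1 1 = 0 →
      (∀ s ∈ Icc (0 : ℝ) 1, HasDerivWithinAt (curveExtend q.1) (curveExtend q.2 s) (Icc 0 1) s) →
      ∀ s ∈ Ioo (0 : ℝ) 1, 0 < curveExtend q.1 s := by
  -- Within `η` of the ends the sign of the slope decides; on the middle interval, nonempty since `η
  -- < 1 / 3`, compactness gives a positive lower bound.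
  obtain ⟨η, hη, hη3, hη0, hη1⟩ : ∃ η > (0 : ℝ), η < 1 / 3 ∧
      (∀ s ∈ Icc 0 η, curveExtend d₀ 0 / 2 < curveExtend d₀ s) ∧
      (∀ s ∈ Icc (1 - η) 1, curveExtend d₀ s < curveExtend d₀ 1 / 2) := by
    have e0 : ∀ᶠ s in 𝓝 (0 : ℝ), curveExtend d₀ 0 / 2 < curveExtend d₀ s :=
      (continuous_curveExtend d₀).continuousAt.eventually (lt_mem_nhds (by linarith))
    have e1 : ∀ᶠ s in 𝓝 (1 : ℝ), curveExtend d₀ s < curveExtend d₀ 1 / 2 :=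
      (continuous_curveExtend d₀).continuousAt.eventually (gt_mem_nhds (by linarith))
    obtain ⟨a, ha, ha'⟩ := Metric.eventually_nhds_iff.1 e0
    obtain ⟨b, hb, hb'⟩ := Metric.eventually_nhds_iff.1 e1
    refine ⟨min (min a b) (1 / 3) / 2, by positivity, ?_, fun s hs => ha' ?_, fun s hs => hb' ?_⟩
    · have := min_le_right (min a b) (1 / 3)
      linarith
    · have h1 := (min_le_left (min a b) (1 / 3)).trans (min_le_left a b)
      rw [Real.dist_eq, abs_lt]
      constructor <;> linarith [hs.1, hs.2]
    · have h1 := (min_le_left (min a b) (1 / 3)).trans (min_le_right a b)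
      rw [Real.dist_eq, abs_lt]
      constructor <;> linarith [hs.1, hs.2]
  obtain ⟨c, hc, hcx⟩ : ∃ c > (0 : ℝ), ∀ s ∈ Icc η (1 - η), c ≤ curveExtend x₀ s := by
    obtain ⟨s₀, hs₀, hmin⟩ := (isCompact_Icc : IsCompact (Icc η (1 - η))).exists_isMinOn
      ⟨η, by constructor <;> linarith⟩ (continuous_curveExtend x₀).continuousOn
    exact ⟨_, hpos s₀ ⟨by linarith [hs₀.1], by linarith [hs₀.2]⟩, fun s hs => hmin hs⟩
  set δ := min c (min (curveExtend d₀ 0 / 2) (-curveExtend d₀ 1 / 2)) with hδdef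
  have hδ : 0 < δ := by
    refine lt_min hc (lt_min ?_ ?_) <;> linarith
  filter_upwards [Metric.ball_mem_nhds (x₀, d₀) hδ] with q hq e0 e1 hder s hs
  rw [Metric.mem_ball, Prod.dist_eq, max_lt_iff] at hq
  have hx : ∀ t, |curveExtend q.1 t - curveExtend x₀ t| < δ := fun t =>
    (ContinuousMap.dist_apply_le_dist _).trans_lt hq.1
  have hd : ∀ t, |curveExtend q.2 t - curveExtend d₀ t| < δ := fun t =>
    (ContinuousMap.dist_apply_le_dist _).trans_lt hq.2
  have hderiv : ∀ t ∈ Ioo (0 : ℝ) 1, deriv (curveExtend q.1) t = curveExtend q.2 t := fun t ht =>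
    ((hder t (Ioo_subset_Icc_self ht)).hasDerivAt (Icc_mem_nhds ht.1 ht.2)).deriv
  have hδc : δ ≤ c := min_le_left _ _
  have hδ0 : δ ≤ curveExtend d₀ 0 / 2 := (min_le_right _ _).trans (min_le_left _ _)
  have hδ1 : δ ≤ -curveExtend d₀ 1 / 2 := (min_le_right _ _).trans (min_le_right _ _)
  rcases lt_or_ge s η with hsη | hsη
  · have hmono : StrictMonoOn (curveExtend q.1) (Icc 0 η) := by
      refine strictMonoOn_of_deriv_pos (convex_Icc _ _)
        (continuous_curveExtend q.1).continuousOn fun t ht => ?_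
      rw [interior_Icc] at ht
      rw [hderiv t ⟨ht.1, by linarith [ht.2]⟩]
      have := hη0 t (Ioo_subset_Icc_self ht)
      have := (abs_lt.1 (hd t)).1
      linarith
    have := hmono ⟨le_rfl, hη.le⟩ ⟨hs.1.le, hsη.le⟩ hs.1
    rwa [e0] at this
  · rcases le_or_gt s (1 - η) with hs1 | hs1
    · have h2 := hcx s ⟨hsη, hs1⟩
      have := (abs_lt.1 (hx s)).1
      linarith
    · have hmono : StrictAntiOn (curveExtend q.1) (Icc (1 - η) 1) := by
        refine strictAntiOn_of_deriv_neg (convex_Icc _ _)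
          (continuous_curveExtend q.1).continuousOn fun t ht => ?_
        rw [interior_Icc] at ht
        rw [hderiv t ⟨by linarith [ht.1], ht.2⟩]
        have := hη1 t (Ioo_subset_Icc_self ht)
        have := (abs_lt.1 (hd t)).2
        linarith
      have := hmono ⟨hs1.le, hs.2.le⟩ ⟨by linarith, le_rfl⟩ hs.2
      rwa [e1] at this

section ProdDeriv

variable {E F : Type*} [NormedAddCommGroup E] [NormedSpace ℝ E] [NormedAddCommGroup F]
  [NormedSpace ℝ F] {f : ℝ → E × F} {f' : E × F} {s : Set ℝ} {x : ℝ}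

lemma HasDerivWithinAt.prod_fst (h : HasDerivWithinAt f f' s x) :
    HasDerivWithinAt (fun t => (f t).1) f'.1 s x :=
  (hasFDerivAt_fst (𝕜 := ℝ) (E := E) (F := F)).comp_hasDerivWithinAt x h

lemma HasDerivWithinAt.prod_snd (h : HasDerivWithinAt f f' s x) :
    HasDerivWithinAt (fun t => (f t).2) f'.2 s x :=
  (hasFDerivAt_snd (𝕜 := ℝ) (E := E) (F := F)).comp_hasDerivWithinAt x h

end ProdDeriv

/-! ### Arcs as time-one orbits of an autonomous field -/

section Arc

variable (v : ℝ → ℝ) (a b : ℝ × ℝ × ℝ → ℝ)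

/-- `z` solves `x' = y + ε b(x, y, t)`, `y' = -v(x) - ε a(x, y, t)` on `[t₀, t₁]`. -/
def IsTrajectory (ε : ℝ) (z : ℝ → Plane) (t₀ t₁ : ℝ) : Prop :=
  ∀ t ∈ Icc t₀ t₁, HasDerivWithinAt z
    ((z t).2 + ε * b ((z t).1, (z t).2, t), -(v (z t).1 + ε * a ((z t).1, (z t).2, t)))
    (Icc t₀ t₁) t

/-- The power `v b - y a` of the perturbation along a curve. -/
noncomputable def powerAlong (z : ℝ → Plane) (t : ℝ) : ℝ :=
  v (z t).1 * b ((z t).1, (z t).2, t) - (z t).2 * a ((z t).1, (z t).2, t)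

/-- There is a trajectory from `(0, y)` at time `t` to `(0, y')` at time `t'`, for `p = (y, t)` and
`p' = (y', t')`, that stays in `x > 0` in between, and along which the perturbation does work
`w`. -/
def IsArc (ε : ℝ) (p p' : ℝ × ℝ) (w : ℝ) : Prop :=
  0 < p.1 ∧ p'.1 < 0 ∧ p.2 < p'.2 ∧ ∃ z : ℝ → Plane, z p.2 = (0, p.1) ∧ z p'.2 = (0, p'.1) ∧
    (∀ t ∈ Ioo p.2 p'.2, 0 < (z t).1) ∧ IsTrajectory v a b ε z p.2 p'.2 ∧
    w = ∫ t in p.2..p'.2, powerAlong v a b z t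

/-- The autonomous field on `(x, y, t, ε, τ, w)` whose time-one map describes trajectories of
length `τ`, together with the work `w` done along them. -/
def arcField (u : ℝ × ℝ × ℝ × ℝ × ℝ × ℝ) : ℝ × ℝ × ℝ × ℝ × ℝ × ℝ :=
  let (x, y, t, ε, τ, _) := u
  (τ * (y + ε * b (x, y, t)), τ * -(v x + ε * a (x, y, t)), τ, 0, 0,
    τ * (v x * b (x, y, t) - y * a (x, y, t)))

/-- The rescaled lift to the phase space of `arcField` of a curve in the plane. -/
noncomputable def arcLift (ε : ℝ) (z : ℝ → Plane) (t₀ τ s : ℝ) : ℝ × ℝ × ℝ × ℝ × ℝ × ℝ :=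
  ((z (t₀ + τ * s)).1, (z (t₀ + τ * s)).2, t₀ + τ * s, ε, τ,
    ∫ t in t₀..(t₀ + τ * s), powerAlong v a b z t)

variable {v a b}

lemma contDiff_arcField (hv : ContDiff ℝ 1 v) (ha : ContDiff ℝ 1 a) (hb : ContDiff ℝ 1 b) :
    ContDiff ℝ 1 (arcField v a b) := by
  unfold arcField
  fun_prop

lemma IsTrajectory.continuousOn {ε : ℝ} {z : ℝ → Plane} {t₀ t₁ : ℝ}
    (hz : IsTrajectory v a b ε z t₀ t₁) : ContinuousOn z (Icc t₀ t₁) :=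
  fun t ht => (hz t ht).continuousWithinAt

lemma IsTrajectory.continuousOn_powerAlong (hv : Continuous v) (ha : Continuous a)
    (hb : Continuous b) {ε : ℝ} {z : ℝ → Plane} {t₀ t₁ : ℝ}
    (hz : IsTrajectory v a b ε z t₀ t₁) : ContinuousOn (powerAlong v a b z) (Icc t₀ t₁) := by
  have hz1 : ContinuousOn (fun t => (z t).1) (Icc t₀ t₁) := hz.continuousOn.fst
  have hz2 : ContinuousOn (fun t => (z t).2) (Icc t₀ t₁) := hz.continuousOn.snd
  have h3 : ContinuousOn (fun t => ((z t).1, (z t).2, t)) (Icc t₀ t₁) :=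
    hz1.prodMk (hz2.prodMk continuousOn_id)
  exact ((hv.comp_continuousOn hz1).mul (hb.comp_continuousOn h3)).sub
    (hz2.mul (ha.comp_continuousOn h3))

lemma hasDerivWithinAt_integral_Icc {E : Type*} [NormedAddCommGroup E] [NormedSpace ℝ E]
    [CompleteSpace E] {f : ℝ → E} {t₀ t₁ t : ℝ} (hf : ContinuousOn f (Icc t₀ t₁))
    (ht : t ∈ Icc t₀ t₁) :
    HasDerivWithinAt (fun t => ∫ s in t₀..t, f s) (f t) (Icc t₀ t₁) t := by
  have : Fact (t ∈ Icc t₀ t₁) := ⟨ht⟩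
  refine intervalIntegral.integral_hasDerivWithinAt_right
    ((hf.mono ?_).intervalIntegrable)
    (hf.stronglyMeasurableAtFilter_nhdsWithin measurableSet_Icc t) (hf t ht)
  rw [uIcc_of_le ht.1]
  exact Icc_subset_Icc_right ht.2

/-- Every duration `τ` up to `t₁ - t₀` is allowed, not only the full one, because the endpoint will
be differentiated with respect to `τ`. -/
lemma IsTrajectory.hasDerivWithinAt_arcLift (hv : Continuous v) (ha : Continuous a)
    (hb : Continuous b) {ε : ℝ} {z : ℝ → Plane} {t₀ t₁ τ : ℝ} (hz : IsTrajectory v a b ε z t₀ t₁)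
    (hτ : τ ∈ Icc 0 (t₁ - t₀)) {s : ℝ} (hs : s ∈ Icc (0 : ℝ) 1) :
    HasDerivWithinAt (arcLift v a b ε z t₀ τ) (arcField v a b (arcLift v a b ε z t₀ τ s))
      (Icc 0 1) s := by
  have hmaps : MapsTo (fun s => t₀ + τ * s) (Icc (0 : ℝ) 1) (Icc t₀ t₁) := fun r hr =>
    ⟨by nlinarith [hr.1, hτ.1], by nlinarith [hr.1, hr.2, hτ.1, hτ.2]⟩
  have haff : HasDerivWithinAt (fun s => t₀ + τ * s) τ (Icc (0 : ℝ) 1) s := by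
    simpa using (((hasDerivAt_id s).const_mul τ).const_add t₀).hasDerivWithinAt
  have h1 := (hz _ (hmaps hs)).scomp s haff hmaps
  have h2 := (hasDerivWithinAt_integral_Icc (hz.continuousOn_powerAlong hv ha hb)
    (hmaps hs)).scomp s haff hmaps
  have h1x := h1.prod_fst
  have h1y := h1.prod_snd
  exact h1x.prodMk (h1y.prodMk (haff.prodMk ((hasDerivWithinAt_const _ _ _).prodMk
    ((hasDerivWithinAt_const _ _ _).prodMk h2))))

/-- Converse of the lift: the parameters `ε` and `τ` are constant along `U` and its clock is affine,
so undoing the time change recovers a planar trajectory and the last coordinate is its work. -/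
lemma isArc_of_arcField {U : ℝ → ℝ × ℝ × ℝ × ℝ × ℝ × ℝ} {y t ε τ : ℝ}
    (hU0 : U 0 = (0, y, t, ε, τ, 0)) (hv : Continuous v) (ha : Continuous a) (hb : Continuous b)
    (hU : ∀ s ∈ Icc (0 : ℝ) 1, HasDerivWithinAt U (arcField v a b (U s)) (Icc 0 1) s)
    (hy : 0 < y) (hτ : 0 < τ) (hpos : ∀ s ∈ Ioo (0 : ℝ) 1, 0 < (U s).1) (hx1 : (U 1).1 = 0)
    (hy1 : (U 1).2.1 < 0) :
    IsArc v a b ε (y, t) ((U 1).2.1, t + τ) (U 1).2.2.2.2.2 := by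
  have d1 : ∀ s ∈ Icc (0 : ℝ) 1, HasDerivWithinAt (fun s => (U s).2) (arcField v a b (U s)).2
      (Icc 0 1) s := fun s hs => (hU s hs).prod_snd
  have d2 : ∀ s ∈ Icc (0 : ℝ) 1, HasDerivWithinAt (fun s => (U s).2.2) (arcField v a b (U s)).2.2
      (Icc 0 1) s := fun s hs => (d1 s hs).prod_snd
  have d3 : ∀ s ∈ Icc (0 : ℝ) 1, HasDerivWithinAt (fun s => (U s).2.2.2)
      (arcField v a b (U s)).2.2.2 (Icc 0 1) s :=
    fun s hs => (d2 s hs).prod_snd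
  have d4 : ∀ s ∈ Icc (0 : ℝ) 1, HasDerivWithinAt (fun s => (U s).2.2.2.2)
      (arcField v a b (U s)).2.2.2.2 (Icc 0 1) s :=
    fun s hs => (d3 s hs).prod_snd
  have d5 : ∀ s ∈ Icc (0 : ℝ) 1, HasDerivWithinAt (fun s => (U s).2.2.2.2.2)
      (arcField v a b (U s)).2.2.2.2.2 (Icc 0 1) s :=
    fun s hs => (d4 s hs).prod_snd
  have right : ∀ {f : ℝ → ℝ} {f' : ℝ} {s : ℝ}, s ∈ Ico (0 : ℝ) 1 →
      HasDerivWithinAt f f' (Icc 0 1) s → HasDerivWithinAt f f' (Ici s) s := by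
    intro f f' s hs h
    refine h.mono_of_mem_nhdsWithin ?_
    exact mem_of_superset (Icc_mem_nhdsGE hs.2) (Icc_subset_Icc_left hs.1)
  have c3 : ∀ s ∈ Icc (0 : ℝ) 1, (U s).2.2.2.1 = ε := by
    have key : ∀ s ∈ Icc (0 : ℝ) 1, HasDerivWithinAt (fun s => (U s).2.2.2.1) 0 (Icc 0 1) s :=
      fun s hs => (d3 s hs).prod_fst
    intro s hs
    rw [constant_of_has_deriv_right_zero (fun s hs => (key s hs).continuousWithinAt)
      (fun s hs => right hs (key s (Ico_subset_Icc_self hs))) s hs, hU0]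
  have c4 : ∀ s ∈ Icc (0 : ℝ) 1, (U s).2.2.2.2.1 = τ := by
    have key : ∀ s ∈ Icc (0 : ℝ) 1, HasDerivWithinAt (fun s => (U s).2.2.2.2.1) 0 (Icc 0 1) s :=
      fun s hs => (d4 s hs).prod_fst
    intro s hs
    rw [constant_of_has_deriv_right_zero (fun s hs => (key s hs).continuousWithinAt)
      (fun s hs => right hs (key s (Ico_subset_Icc_self hs))) s hs, hU0]
  have c2 : ∀ s ∈ Icc (0 : ℝ) 1, (U s).2.2.1 = t + τ * s := by
    have key : ∀ s ∈ Icc (0 : ℝ) 1,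
        HasDerivWithinAt (fun s => (U s).2.2.1 - τ * s) 0 (Icc 0 1) s := by
      intro s hs
      have h1 := (d2 s hs).prod_fst
      have h2 : HasDerivWithinAt (fun s => τ * s) τ (Icc (0 : ℝ) 1) s := by
        simpa using ((hasDerivAt_id s).const_mul τ).hasDerivWithinAt
      have h3 := h1.sub h2
      have h4 : (arcField v a b (U s)).2.2.1 = τ := c4 s hs
      convert! h3 using 1
      rw [← h4]
      simp
    intro s hs
    have := constant_of_has_deriv_right_zero (fun s hs => (key s hs).continuousWithinAt)
      (fun s hs => right hs (key s (Ico_subset_Icc_self hs))) s hs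
    rw [hU0] at this
    simp only [mul_zero, sub_zero] at this
    linarith
  set g : ℝ → ℝ := fun r => (r - t) / τ with hg
  have hgd : ∀ r, HasDerivAt g (1 / τ) r := fun r => by
    simpa using ((hasDerivAt_id r).sub_const t).div_const τ
  have hmaps : MapsTo g (Icc t (t + τ)) (Icc 0 1) := fun r hr =>
    ⟨div_nonneg (by linarith [hr.1]) hτ.le, (div_le_one hτ).2 (by linarith [hr.2])⟩
  have hgt : ∀ r, t + τ * g r = r := fun r => by
    simp only [hg]; field_simp; ring
  have hg0 : g t = 0 := by simp [hg]
  have hg1 : g (t + τ) = 1 := by simp [hg, hτ.ne']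
  set z : ℝ → Plane := fun r => ((U (g r)).1, (U (g r)).2.1) with hzdef
  have hdx : ∀ r ∈ Icc t (t + τ), HasDerivWithinAt (fun r => (U (g r)).1)
      ((z r).2 + ε * b ((z r).1, (z r).2, r)) (Icc t (t + τ)) r := by
    intro r hr
    have h := (hU _ (hmaps hr)).prod_fst.scomp r
      (hgd r).hasDerivWithinAt hmaps
    convert! h using 1
    have e3 := c3 _ (hmaps hr)
    have e4 := c4 _ (hmaps hr)
    have e2 := c2 _ (hmaps hr)
    rw [hgt] at e2
    simp only [arcField, smul_eq_mul, e2, e3, e4, hzdef]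
    field_simp
  have hdy : ∀ r ∈ Icc t (t + τ), HasDerivWithinAt (fun r => (U (g r)).2.1)
      (-(v (z r).1 + ε * a ((z r).1, (z r).2, r))) (Icc t (t + τ)) r := by
    intro r hr
    have h := (d1 _ (hmaps hr)).prod_fst.scomp r
      (hgd r).hasDerivWithinAt hmaps
    convert! h using 1
    have e3 := c3 _ (hmaps hr)
    have e4 := c4 _ (hmaps hr)
    have e2 := c2 _ (hmaps hr)
    rw [hgt] at e2
    simp only [arcField, smul_eq_mul, e2, e3, e4, hzdef]
    field_simp
  have hdw : ∀ r ∈ Icc t (t + τ), HasDerivWithinAt (fun r => (U (g r)).2.2.2.2.2)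
      (powerAlong v a b z r) (Icc t (t + τ)) r := by
    intro r hr
    have h := (d5 _ (hmaps hr)).scomp r (hgd r).hasDerivWithinAt hmaps
    convert! h using 1
    have e3 := c3 _ (hmaps hr)
    have e4 := c4 _ (hmaps hr)
    have e2 := c2 _ (hmaps hr)
    rw [hgt] at e2
    simp only [powerAlong, arcField, smul_eq_mul, e2, e4, hzdef]
    field_simp
  have htraj : IsTrajectory v a b ε z t (t + τ) := fun r hr => (hdx r hr).prodMk (hdy r hr)
  refine ⟨hy, hy1, by simpa using hτ, z, ?_, ?_, ?_, htraj, ?_⟩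
  · simp [hzdef, hg0, hU0]
  · simp [hzdef, hg1, hx1]
  · intro r hr
    refine hpos _ ⟨div_pos (by linarith [hr.1]) hτ, (div_lt_one hτ).2 (by linarith [hr.2])⟩
  · have hle : t ≤ t + τ := by linarith
    rw [intervalIntegral.integral_eq_sub_of_hasDeriv_right_of_le (f := fun r => (U (g r)).2.2.2.2.2)
      hle (fun r hr => (hdw r hr).continuousWithinAt) (fun r hr => ((hdw r
        (Ioo_subset_Icc_self hr)).hasDerivAt (Icc_mem_nhds hr.1 hr.2)).hasDerivWithinAt) ?_]
    · simp [hg0, hg1, hU0]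
    · refine ContinuousOn.intervalIntegrable ?_
      rw [uIcc_of_le hle]
      exact htraj.continuousOn_powerAlong hv ha hb

end Arc

/-! ### Energy balance, uniqueness and regularity of arcs -/

section Arc

variable {v : ℝ → ℝ} {a b : ℝ × ℝ × ℝ → ℝ}

lemma HasDerivWithinAt.Ici_of_Icc {E : Type*} [NormedAddCommGroup E] [NormedSpace ℝ E] {f : ℝ → E}
    {f' : E} {c d s : ℝ} (h : HasDerivWithinAt f f' (Icc c d) s) (hs : s ∈ Ico c d) :
    HasDerivWithinAt f f' (Ici s) s :=
  h.mono_of_mem_nhdsWithin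
    (mem_of_superset (Icc_mem_nhdsGE hs.2) (Icc_subset_Icc_left hs.1))

/-- Energy balance along an arc. -/
lemma IsArc.energy {V : ℝ → ℝ} (hV : ∀ x, HasDerivAt V (v x) x) (hv : Continuous v)
    (ha : Continuous a) (hb : Continuous b) {ε : ℝ} {p p' : ℝ × ℝ} {w : ℝ}
    (h : IsArc v a b ε p p' w) : p'.1 ^ 2 / 2 = p.1 ^ 2 / 2 + ε * w := by
  obtain ⟨-, -, hlt, z, hz0, hz1, -, hz, rfl⟩ := h
  have hE : ∀ t ∈ Icc p.2 p'.2, HasDerivWithinAt (fun t => (z t).2 ^ 2 / 2 + V (z t).1)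
      (ε * powerAlong v a b z t) (Icc p.2 p'.2) t := by
    intro t ht
    have h1 := ((hz t ht).prod_snd.pow 2).div_const 2
    have h2 := (hV (z t).1).comp_hasDerivWithinAt t (hz t ht).prod_fst
    convert! h1.add h2 using 1
    simp only [powerAlong]
    push_cast
    ring
  have hcont := (hz.continuousOn_powerAlong hv ha hb)
  have := intervalIntegral.integral_eq_sub_of_hasDeriv_right_of_le hlt.le
    (fun t ht => (hE t ht).continuousWithinAt)
    (fun t ht => ((hE t (Ioo_subset_Icc_self ht)).hasDerivAt
      (Icc_mem_nhds ht.1 ht.2)).hasDerivWithinAt)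
    (ContinuousOn.intervalIntegrable (by
      rw [uIcc_of_le hlt.le]; exact continuousOn_const.mul hcont))
  rw [intervalIntegral.integral_const_mul, hz0, hz1] at this
  simp only at this
  linarith

/-- The field of the unperturbed system. -/
def potentialField (v : ℝ → ℝ) (z : Plane) : Plane := (z.2, -v z.1)

lemma contDiff_potentialField (hv : ContDiff ℝ 1 v) : ContDiff ℝ 1 (potentialField v) := by
  unfold potentialField
  fun_prop

lemma isTrajectory_zero_iff {z : ℝ → Plane} {t₀ t₁ : ℝ} :
    IsTrajectory v a b 0 z t₀ t₁ ↔
      ∀ t ∈ Icc t₀ t₁, HasDerivWithinAt z (potentialField v (z t)) (Icc t₀ t₁) t := by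
  simp [IsTrajectory, potentialField]

/-- Unperturbed arcs with the same initial point coincide. -/
lemma IsTrajectory.eqOn_zero (hv : ContDiff ℝ 1 v) {z z' : ℝ → Plane} {t₀ t₁ t₁' : ℝ}
    (hz : IsTrajectory v a b 0 z t₀ t₁) (hz' : IsTrajectory v a b 0 z' t₀ t₁')
    (h0 : z t₀ = z' t₀) : EqOn z z' (Icc t₀ (min t₁ t₁')) := by
  rw [isTrajectory_zero_iff] at hz hz'
  have s1 : Icc t₀ (min t₁ t₁') ⊆ Icc t₀ t₁ := Icc_subset_Icc_right (min_le_left _ _)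
  have s2 : Icc t₀ (min t₁ t₁') ⊆ Icc t₀ t₁' := Icc_subset_Icc_right (min_le_right _ _)
  refine eqOn_Icc_of_hasDerivWithinAt_Ici (contDiff_potentialField hv)
    (fun t ht => ((hz t (s1 ht)).mono s1).continuousWithinAt)
    (fun t ht => ((hz' t (s2 ht)).mono s2).continuousWithinAt)
    (fun t ht => (hz t (s1 (Ico_subset_Icc_self ht))).Ici_of_Icc
      ⟨ht.1, ht.2.trans_le (min_le_left _ _)⟩)
    (fun t ht => (hz' t (s2 (Ico_subset_Icc_self ht))).Ici_of_Icc
      ⟨ht.1, ht.2.trans_le (min_le_right _ _)⟩) h0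

/-- The trajectories agree as long as both last, and if one returned earlier its endpoint on `x = 0`
would lie inside the other, where `x > 0`. This identifies the abstract arc map at `ε = 0` with the
given orbits. -/
lemma IsArc.unique_zero (hv : ContDiff ℝ 1 v) {p p₁ p₂ : ℝ × ℝ} {w₁ w₂ : ℝ}
    (h₁ : IsArc v a b 0 p p₁ w₁) (h₂ : IsArc v a b 0 p p₂ w₂) : p₁ = p₂ ∧ w₁ = w₂ := by
  obtain ⟨-, -, l₁, z₁, s₁, e₁, pos₁, tr₁, W₁⟩ := h₁
  obtain ⟨-, -, l₂, z₂, s₂, e₂, pos₂, tr₂, W₂⟩ := h₂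
  have heq := tr₁.eqOn_zero hv tr₂ (s₁.trans s₂.symm)
  have ht : p₁.2 = p₂.2 := by
    rcases lt_trichotomy p₁.2 p₂.2 with hlt | h | hlt
    · have := heq ⟨l₁.le, by rw [min_eq_left hlt.le]⟩
      have hp := pos₂ p₁.2 ⟨l₁, hlt⟩
      rw [← this, e₁] at hp
      exact absurd hp (lt_irrefl _)
    · exact h
    · have := heq ⟨l₂.le, by rw [min_eq_right hlt.le]⟩
      have hp := pos₁ p₂.2 ⟨l₂, hlt⟩
      rw [this, e₂] at hp
      exact absurd hp (lt_irrefl _)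
  rw [ht, min_self] at heq
  have hend : p₁ = p₂ := by
    have := heq ⟨l₂.le, le_rfl⟩
    rw [← ht, e₁, ht, e₂] at this
    exact Prod.ext (congrArg Prod.snd this) ht
  refine ⟨hend, ?_⟩
  rw [W₁, W₂, hend]
  refine intervalIntegral.integral_congr fun t ht => ?_
  rw [uIcc_of_le l₂.le] at ht
  simp only [powerAlong, heq ht]

/-- Near an unperturbed arc, the arcs depend strictly differentiably on the initial data and on the
perturbation parameter. -/
theorem exists_arcMap_hasStrictFDerivAt (hv : ContDiff ℝ 1 v) (ha : ContDiff ℝ 1 a)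
    (hb : ContDiff ℝ 1 b) {y₀ t₀ y₁ t₁ w₀ : ℝ} (h : IsArc v a b 0 (y₀, t₀) (y₁, t₁) w₀) :
    ∃ (P : ℝ × ℝ × ℝ → ℝ × ℝ × ℝ) (L : ℝ × ℝ × ℝ →L[ℝ] ℝ × ℝ × ℝ),
      HasStrictFDerivAt P L (y₀, t₀, 0) ∧ P (y₀, t₀, 0) = (y₁, t₁, w₀) ∧
      ∀ᶠ p in 𝓝 (y₀, t₀, (0 : ℝ)),
        IsArc v a b p.2.2 (p.1, p.2.1) ((P p).1, (P p).2.1) (P p).2.2 := by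
  obtain ⟨hy₀, hy₁, hlt, z, hz0, hz1, hpos, hz, hw⟩ := h
  simp only at hy₀ hy₁ hlt hz0 hz1 hpos hz hw
  have hcv := hv.continuous
  have hca := ha.continuous
  have hcb := hb.continuous
  set θ := t₁ - t₀ with hθ
  have hθ0 : 0 < θ := sub_pos.2 hlt
  have hθt : t₀ + θ = t₁ := by simp [hθ]
  have hX := contDiff_arcField hv ha hb
  have hγ : ∀ τ ∈ Icc 0 θ, ∀ s ∈ Icc (0 : ℝ) 1, HasDerivWithinAt (arcLift v a b 0 z t₀ τ)
      (arcField v a b (arcLift v a b 0 z t₀ τ s)) (Icc 0 1) s :=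
    fun τ hτ s hs => hz.hasDerivWithinAt_arcLift hcv hca hcb hτ hs
  have hγ0 : ∀ τ, arcLift v a b 0 z t₀ τ 0 = (0, y₀, t₀, 0, τ, 0) := fun τ => by
    simp [arcLift, hz0]
  have hγ1 : arcLift v a b 0 z t₀ θ 1 = (0, y₁, t₁, 0, θ, w₀) := by
    simp [arcLift, hθt, hz1, hw]
  obtain ⟨Ψ, L, hΨ, hΨ0, hΨev⟩ := exists_flow_hasStrictFDerivAt hX (hγ θ ⟨hθ0.le, le_rfl⟩)
  rw [hγ0] at hΨ hΨ0 hΨev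
  -- Initial data on the section, with zero work, and with the duration still free.
  set ι : (ℝ × ℝ × ℝ) × ℝ → ℝ × ℝ × ℝ × ℝ × ℝ × ℝ :=
    fun q => (0, q.1.1, q.1.2.1, q.1.2.2, q.2, 0) with hι
  have hιd : ContDiff ℝ 1 ι := by simp only [hι]; fun_prop
  set p₀ : ℝ × ℝ × ℝ := (y₀, t₀, 0) with hp₀
  have hι0 : ι (p₀, θ) = (0, y₀, t₀, 0, θ, 0) := rfl
  have hιs := hιd.contDiffAt.hasStrictFDerivAt (x := (p₀, θ)) one_ne_zero
  set e : (ℝ × ℝ × ℝ) × ℝ → ℝ × ℝ × ℝ × ℝ × ℝ × ℝ := fun q => Ψ (ι q) 1 with he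
  obtain ⟨e', hed⟩ : ∃ e', HasStrictFDerivAt e e' (p₀, θ) :=
    ⟨_, (ContinuousMap.evalCLM ℝ (1 : unitInterval)).hasStrictFDerivAt.comp (p₀, θ)
      (HasStrictFDerivAt.comp (g := Ψ) (p₀, θ) (by rw [hι0]; exact hΨ) hιs)⟩
  have he0 : e (p₀, θ) = (0, y₁, t₁, 0, θ, w₀) := by
    have := hΨ0 1
    rw [show ((1 : unitInterval) : ℝ) = 1 from rfl, hγ1] at this
    simp only [he, hι0, this]
  -- The return time solves `f = 0` for the duration; its derivative in the duration is the crossing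
  -- velocity `y₁ ≠ 0`.
  set f : (ℝ × ℝ × ℝ) × ℝ → ℝ := fun q => (e q).1 with hf
  have hfd : HasStrictFDerivAt f (ContinuousLinearMap.fst ℝ ℝ (ℝ × ℝ × ℝ × ℝ × ℝ) ∘L e')
      (p₀, θ) := (ContinuousLinearMap.fst ℝ ℝ _).hasStrictFDerivAt.comp _ hed
  set f' := ContinuousLinearMap.fst ℝ ℝ (ℝ × ℝ × ℝ × ℝ × ℝ) ∘L e' with hf'
  have hιcont : Continuous ι := hιd.continuous
  -- the derivative with respect to the length, from the left
  have hpartial : f' (0, 1) = y₁ := by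
    have hd1 : HasDerivAt (fun τ : ℝ => f (p₀, τ)) (f' (0, 1)) θ :=
      hfd.hasFDerivAt.comp_hasDerivAt θ ((hasDerivAt_const θ p₀).prodMk (hasDerivAt_id θ))
    have hd2 : HasDerivWithinAt (fun τ => (z (t₀ + τ)).1) y₁ (Icc 0 θ) θ := by
      have haff : HasDerivWithinAt (fun τ => t₀ + τ) 1 (Icc 0 θ) θ :=
        ((hasDerivAt_id θ).const_add t₀).hasDerivWithinAt
      have h1 := (hz (t₀ + θ) ⟨by linarith, by linarith⟩).prod_fst.scomp θ haff
        (fun τ hτ => ⟨by linarith [hτ.1], by linarith [hτ.2]⟩)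
      have hval : (1 : ℝ) • ((z (t₀ + θ)).2 + 0 * b ((z (t₀ + θ)).1, (z (t₀ + θ)).2, t₀ + θ)) = y₁ := by
        simp [hθt, hz1]
      rw [← hval]
      exact h1
    -- The curve `z` is a known solution only up to `t₁`, so it can be compared with the flow only
    -- for `τ ≤ θ`. As `f` is differentiable, its left derivative is enough.
    have hev : ∀ᶠ τ in 𝓝[Icc 0 θ] θ, f (p₀, τ) = (z (t₀ + τ)).1 := by
      have hc : Tendsto (fun τ => ι (p₀, τ)) (𝓝[Icc 0 θ] θ) (𝓝 (0, y₀, t₀, 0, θ, 0)) :=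
        ((hιcont.comp (by fun_prop : Continuous fun τ : ℝ => (p₀, τ))).tendsto θ).mono_left
          nhdsWithin_le_nhds
      filter_upwards [hc.eventually hΨev, self_mem_nhdsWithin] with τ hτ hτm
      have hE := eqOn_Icc_of_hasDerivWithinAt_Ici hX
        (fun s hs => (hτ.2 s hs).continuousWithinAt)
        (fun s hs => (hγ τ hτm s hs).continuousWithinAt)
        (fun s hs => (hτ.2 s (Ico_subset_Icc_self hs)).Ici_of_Icc hs)
        (fun s hs => (hγ τ hτm s (Ico_subset_Icc_self hs)).Ici_of_Icc hs)
        (by rw [hτ.1, hγ0])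
      have := hE (right_mem_Icc.2 zero_le_one)
      rw [curveExtend_of_mem _ (right_mem_Icc.2 zero_le_one)] at this
      change (Ψ (ι (p₀, τ)) ⟨1, _⟩).1 = _
      rw [this]
      simp [arcLift]
    have hd3 := hd2.congr_of_eventuallyEq hev
      (by simp only [hf, he0, hθt, hz1])
    exact (uniqueDiffOn_Icc hθ0 θ ⟨hθ0.le, le_rfl⟩).eq_deriv _ hd1.hasDerivWithinAt hd3
  have hinv : (f' ∘L ContinuousLinearMap.inr ℝ (ℝ × ℝ × ℝ) ℝ).IsInvertible := by
    have hcoef : ∀ c : ℝ, f' ((0 : ℝ × ℝ × ℝ), c) = c * y₁ := fun c => by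
      have : ((0 : ℝ × ℝ × ℝ), c) = c • ((0 : ℝ × ℝ × ℝ), (1 : ℝ)) := by simp
      rw [this, map_smul, hpartial, smul_eq_mul]
    refine ContinuousLinearMap.IsInvertible.of_inverse
      (g := y₁⁻¹ • ContinuousLinearMap.id ℝ ℝ) ?_ ?_
    · ext
      simp [hcoef, hy₁.ne]
    · ext
      simp [hcoef, hy₁.ne]
  set T := hfd.implicitFunctionOfProdDomain hinv with hT
  have hTd := hfd.hasStrictFDerivAt_implicitFunctionOfProdDomain hinv
  have hT0 : T p₀ = θ :=
    (hfd.eventually_apply_eq_iff_implicitFunctionOfProdDomain hinv).self_of_nhds.1 rfl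
  have hTev := hfd.eventually_apply_implicitFunctionOfProdDomain hinv
  rw [← hT] at hTd hTev
  simp only at hTd hTev
  have hf0 : f (p₀, θ) = 0 := by simp only [hf, he0]
  rw [hf0] at hTev
  have hpair := (hasStrictFDerivAt_id p₀).prodMk hTd
  have hed2 : HasStrictFDerivAt e e' (id p₀, T p₀) := by rw [hT0]; exact hed
  have heT := HasStrictFDerivAt.comp (g := e) p₀ hed2 hpair
  set P : ℝ × ℝ × ℝ → ℝ × ℝ × ℝ :=
    fun p => ((e (p, T p)).2.1, p.2.1 + T p, (e (p, T p)).2.2.2.2.2) with hP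
  have hPd : ∃ L, HasStrictFDerivAt P L p₀ :=
    ⟨_, heT.snd.fst.prodMk ((hasStrictFDerivAt_snd.fst.add hTd).prodMk heT.snd.snd.snd.snd.snd)⟩
  obtain ⟨LP, hLP⟩ := hPd
  refine ⟨P, LP, hLP, ?_, ?_⟩
  · have h1 : P p₀ = ((e (p₀, T p₀)).2.1, t₀ + T p₀, (e (p₀, T p₀)).2.2.2.2.2) := rfl
    rw [h1, hT0, he0, hθt]
  · have hTc : ContinuousAt T p₀ := hTd.continuousAt
    have hιc : Tendsto (fun p => ι (p, T p)) (𝓝 p₀) (𝓝 (0, y₀, t₀, 0, θ, 0)) := by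
      have : ContinuousAt (fun p => ι (p, T p)) p₀ :=
        hιcont.continuousAt.comp (continuousAt_id.prodMk hTc)
      have h2 : ι (p₀, T p₀) = (0, y₀, t₀, 0, θ, 0) := by rw [hT0]
      rw [ContinuousAt, h2] at this
      exact this
    have e1 : ∀ᶠ p in 𝓝 p₀, 0 < T p := by
      refine hTc.eventually (lt_mem_nhds ?_)
      rw [hT0]; exact hθ0
    have e2 : ∀ᶠ p : ℝ × ℝ × ℝ in 𝓝 p₀, 0 < p.1 :=
      continuous_fst.continuousAt.eventually (lt_mem_nhds hy₀)
    have e3 : ∀ᶠ p in 𝓝 p₀, (e (p, T p)).2.1 < 0 := by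
      have hc : ContinuousAt (fun p => (e (p, T p)).2.1) p₀ := heT.snd.fst.continuousAt
      refine hc.eventually (gt_mem_nhds ?_)
      simp only [hT0, he0]; exact hy₁
    set u₀ := Ψ (0, y₀, t₀, 0, θ, 0) with hu₀
    set fstC : C(ℝ × ℝ × ℝ × ℝ × ℝ × ℝ, ℝ) := ⟨Prod.fst, continuous_fst⟩
    set velC : C(ℝ × ℝ × ℝ × ℝ × ℝ × ℝ, ℝ) :=
      ⟨fun u => (arcField v a b u).1, continuous_fst.comp hX.continuous⟩
    have hcomp : ∀ (g : C(ℝ × ℝ × ℝ × ℝ × ℝ × ℝ, ℝ)) (u : C(unitInterval, _)) (s : ℝ),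
        curveExtend (g.comp u) s = g (curveExtend u s) := fun _ _ _ => rfl
    have hu₀s : ∀ s ∈ Icc (0 : ℝ) 1, curveExtend u₀ s = arcLift v a b 0 z t₀ θ s := fun s hs => by
      rw [curveExtend_of_mem _ hs, hΨ0]
    -- A zero of `x` after time `T p` is an arc only if `x > 0` in between; this survives
    -- perturbation because both end velocities are nonzero and have opposite signs.
    have hpos' := eventually_pos_of_near (fstC.comp u₀) (velC.comp u₀)
      (fun s hs => by
        rw [hcomp, hu₀s s (Ioo_subset_Icc_self hs)]
        exact hpos _ ⟨by nlinarith [hs.1], by nlinarith [hs.2]⟩)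
      (by
        rw [hcomp, hu₀s 0 (by simp), hγ0]
        simpa [velC, arcField] using mul_pos hθ0 hy₀)
      (by
        rw [hcomp, hu₀s 1 (by simp), hγ1]
        simpa [velC, arcField] using mul_neg_of_pos_of_neg hθ0 hy₁)
    have hΨc : Tendsto (fun p => Ψ (ι (p, T p))) (𝓝 p₀) (𝓝 u₀) :=
      (hΨ.continuousAt.tendsto).comp hιc
    have hpc : Tendsto (fun p => (fstC.comp (Ψ (ι (p, T p))), velC.comp (Ψ (ι (p, T p)))))
        (𝓝 p₀) (𝓝 (fstC.comp u₀, velC.comp u₀)) :=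
      (((ContinuousMap.continuous_postcomp fstC).tendsto u₀).comp hΨc).prodMk_nhds
        (((ContinuousMap.continuous_postcomp velC).tendsto u₀).comp hΨc)
    filter_upwards [e1, e2, e3, hTev, hιc.eventually hΨev, hpc.eventually hpos'] with
      p h1 h2 h3 h4 h5 h6
    set U := curveExtend (Ψ (ι (p, T p))) with hU
    have hU1 : U 1 = e (p, T p) := curveExtend_of_mem _ (right_mem_Icc.2 zero_le_one)
    have hU0 : U 0 = (0, p.1, p.2.1, p.2.2, T p, 0) := h5.1
    have := isArc_of_arcField (U := U) hU0 hcv hca hcb h5.2 h2 h1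
      (h6 (by rw [hcomp, ← hU, hU0]; rfl) (by rw [hcomp, ← hU, hU1]; exact h4)
        (fun s hs => (h5.2 s hs).prod_fst))
      (by rw [hU1]; exact h4) (by rw [hU1]; exact h3)
    rw [hU1] at this
    exact this

end Arc

/-! ### First zeros and one-sided derivatives -/

/-- The first zero of a function that starts at zero with positive slope. -/
lemma exists_first_zero {f : ℝ → ℝ} (hf : Continuous f) {a T d : ℝ} (ha : f a = 0)
    (hd : HasDerivWithinAt f d (Ici a) a) (hd0 : 0 < d) (haT : a < T) (hT : f T = 0) :
    ∃ t₁, a < t₁ ∧ t₁ ≤ T ∧ f t₁ = 0 ∧ ∀ t ∈ Ioo a t₁, 0 < f t := by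
  have hev : ∀ᶠ t in 𝓝[>] a, 0 < f t := by
    have h1 := hasDerivWithinAt_iff_tendsto_slope.1 hd
    rw [Ici_sdiff_left] at h1
    filter_upwards [h1.eventually (lt_mem_nhds hd0), self_mem_nhdsWithin] with t ht hta
    rw [slope_def_field, ha, sub_zero] at ht
    exact (div_pos_iff_of_pos_right (sub_pos.2 hta)).1 ht
  obtain ⟨c, hac, hc⟩ := mem_nhdsGT_iff_exists_Ioo_subset.1 hev
  have hac' : a < c := hac
  -- Starting the search at `e` excludes the zero at `a` itself, so a least zero exists by
  -- compactness of `[e, T]`.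
  set e := (a + c) / 2 with he
  have hea : a < e := by simp only [he]; linarith
  have hec : e < c := by simp only [he]; linarith
  have hTc : c ≤ T := by
    by_contra! h
    have : 0 < f T := hc ⟨haT, h⟩
    exact this.ne' hT
  obtain ⟨t₁, ⟨⟨h1, h2⟩, h3⟩, hleast⟩ := ((isCompact_Icc : IsCompact (Icc e T)).inter_right
    (isClosed_eq hf continuous_const : IsClosed {t | f t = 0})).exists_isLeast
    ⟨T, ⟨by linarith, le_rfl⟩, hT⟩
  refine ⟨t₁, hea.trans_le h1, h2, h3, fun t ht => ?_⟩
  rcases lt_or_ge t c with htc | htc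
  · exact hc ⟨ht.1, htc⟩
  · by_contra! hneg
    have hfe : 0 < f e := hc ⟨hea, hec⟩
    obtain ⟨r, hr, hr0⟩ := intermediate_value_Icc' (hec.le.trans htc) hf.continuousOn
      (⟨hneg, hfe.le⟩ : (0 : ℝ) ∈ Icc (f t) (f e))
    have := hleast ⟨⟨hr.1, hr.2.trans (ht.2.le.trans h2)⟩, hr0⟩
    linarith [hr.2, ht.2]

/-- The slope at the right end of an interval of a function that is positive inside and vanishes
at that end. -/
lemma nonpos_of_hasDerivWithinAt_of_pos {f : ℝ → ℝ} {a b d : ℝ} (hab : a < b)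
    (hd : HasDerivWithinAt f d (Icc a b) b) (hpos : ∀ t ∈ Ioo a b, 0 < f t) (hb : f b = 0) :
    d ≤ 0 := by
  have h1 := hasDerivWithinAt_iff_tendsto_slope.1 (hd.mono Ioo_subset_Icc_self)
  have hmem : Ioo a b \ {b} = Ioo a b := sdiff_singleton_eq_self fun h => lt_irrefl _ h.2
  rw [hmem, nhdsWithin_Ioo_eq_nhdsLT hab] at h1
  refine le_of_tendsto h1 ?_
  filter_upwards [Ioo_mem_nhdsLT hab] with t ht
  rw [slope_def_field, hb, sub_zero]
  exact div_nonpos_of_nonneg_of_nonpos (hpos t ht).le (by linarith [ht.2])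

/-- A continuous curve whose right derivative is given by a continuous field is a solution. -/
lemma hasDerivWithinAt_Icc_of_right {E : Type*} [NormedAddCommGroup E] [NormedSpace ℝ E]
    [CompleteSpace E] {X : E → E} (hX : Continuous X) {f : ℝ → E} {a b : ℝ}
    (hf : ContinuousOn f (Icc a b))
    (hd : ∀ t ∈ Ioo a b, HasDerivWithinAt f (X (f t)) (Ici t) t) :
    ∀ t ∈ Icc a b, HasDerivWithinAt f (X (f t)) (Icc a b) t := by
  have hXf : ContinuousOn (fun t => X (f t)) (Icc a b) := hX.comp_continuousOn hf
  have hint : ∀ t ∈ Icc a b, f t = f a + ∫ s in a..t, X (f s) := by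
    intro t ht
    have hsub : Icc a t ⊆ Icc a b := Icc_subset_Icc_right ht.2
    rw [intervalIntegral.integral_eq_sub_of_hasDeriv_right_of_le ht.1 (hf.mono hsub)
      (fun s hs => (hd s ⟨hs.1, hs.2.trans_le ht.2⟩).mono Ioi_subset_Ici_self)
      (ContinuousOn.intervalIntegrable (by rw [uIcc_of_le ht.1]; exact hXf.mono hsub)),
      add_sub_cancel]
  intro t ht
  exact ((hasDerivWithinAt_integral_Icc hXf ht).const_add (f a)).congr hint (hint t ht)

/-! ### The half period as an integral over positions -/

section HalfPeriod

variable {v : ℝ → ℝ}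

/-- The time that an unperturbed orbit spends in `x > 0`, as an integral over positions. -/
theorem two_mul_integral_eq_time {V : ℝ → ℝ} (hV : ∀ x, HasDerivAt V (v x) x)
    (hv : ContDiff ℝ 1 v) (hV0 : V 0 = 0) {z : ℝ → Plane} {y t₁ : ℝ} (hy : 0 < y) (ht₁ : 0 < t₁)
    (hz : ∀ t ∈ Icc 0 t₁, HasDerivWithinAt z (potentialField v (z t)) (Icc 0 t₁) t)
    (hz0 : z 0 = (0, y)) (hz1 : z t₁ = (0, -y)) (hpos : ∀ t ∈ Ioo 0 t₁, 0 < (z t).1) :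
    2 * ∫ x in (0 : ℝ)..sInf {x | 0 < x ∧ V x = y ^ 2 / 2}, 1 / √(2 * (y ^ 2 / 2 - V x)) = t₁ := by
  have hzc : ContinuousOn z (Icc 0 t₁) := fun t ht => (hz t ht).continuousWithinAt
  have hyc : ContinuousOn (fun t => (z t).2) (Icc 0 t₁) := hzc.snd
  have hxc : ContinuousOn (fun t => (z t).1) (Icc 0 t₁) := hzc.fst
  -- conservation of energy
  have hE : ∀ t ∈ Icc 0 t₁, (z t).2 ^ 2 / 2 + V (z t).1 = y ^ 2 / 2 := by
    have key : ∀ t ∈ Icc 0 t₁,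
        HasDerivWithinAt (fun t => (z t).2 ^ 2 / 2 + V (z t).1) 0 (Icc 0 t₁) t := by
      intro t ht
      have h1 := ((hz t ht).prod_snd.pow 2).div_const 2
      have h2 := (hV (z t).1).comp_hasDerivWithinAt t (hz t ht).prod_fst
      convert! h1.add h2 using 1
      simp only [potentialField]
      push_cast
      ring
    intro t ht
    rw [constant_of_has_deriv_right_zero (fun s hs => (key s hs).continuousWithinAt)
      (fun s hs => (key s (Ico_subset_Icc_self hs)).Ici_of_Icc hs) t ht, hz0]
    simp [hV0]
  -- the turning time
  obtain ⟨m, ⟨hm, hm0⟩, hleast⟩ : ∃ m, IsLeast (Icc 0 t₁ ∩ {t | (z t).2 = 0}) m := by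
    have hclosed : IsClosed (Icc 0 t₁ ∩ {t | (z t).2 = 0}) :=
      hyc.preimage_isClosed_of_isClosed isClosed_Icc isClosed_singleton
    obtain ⟨r, hr, hr0⟩ := intermediate_value_Icc' ht₁.le hyc
      (by rw [hz0, hz1]; constructor <;> simp [hy.le] : (0 : ℝ) ∈ Icc (z t₁).2 (z 0).2)
    exact (isCompact_Icc.of_isClosed_subset hclosed inter_subset_left).exists_isLeast ⟨r, hr, hr0⟩
  have hm0' : (z m).2 = 0 := hm0
  have hmpos : 0 < m := by
    refine lt_of_le_of_ne hm.1 fun h => ?_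
    rw [← h, hz0] at hm0'
    exact hy.ne' hm0'
  have hmlt : m < t₁ := by
    refine lt_of_le_of_ne hm.2 fun h => ?_
    rw [h, hz1] at hm0'
    simp only at hm0'
    linarith
  have hypos : ∀ t ∈ Ico 0 m, 0 < (z t).2 := by
    intro t ht
    by_contra! hneg
    obtain ⟨r, hr, hr0⟩ := intermediate_value_Icc' ht.1
      (hyc.mono (Icc_subset_Icc_right (ht.2.le.trans hm.2)))
      (by rw [hz0]; exact ⟨hneg, hy.le⟩ : (0 : ℝ) ∈ Icc (z t).2 (z 0).2)
    have := hleast ⟨⟨hr.1, hr.2.trans (ht.2.le.trans hm.2)⟩, hr0⟩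
    linarith [hr.2, ht.2]
  have hsubm : Icc 0 m ⊆ Icc 0 t₁ := Icc_subset_Icc_right hm.2
  have hxd : ∀ t ∈ Ioo 0 m, HasDerivAt (fun t => (z t).1) (z t).2 t := fun t ht =>
    (hz t (hsubm (Ioo_subset_Icc_self ht))).prod_fst.hasDerivAt
      (Icc_mem_nhds ht.1 (ht.2.trans hmlt))
  have hmono : StrictMonoOn (fun t => (z t).1) (Icc 0 m) := by
    refine strictMonoOn_of_deriv_pos (convex_Icc _ _) (hxc.mono hsubm) fun t ht => ?_
    rw [interior_Icc] at ht
    rw [(hxd t ht).deriv]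
    exact hypos t ⟨ht.1.le, ht.2⟩
  have hx0 : (z 0).1 = 0 := by rw [hz0]
  have himage : (fun t => (z t).1) '' Icc 0 m = Icc 0 (z m).1 := by
    refine Subset.antisymm ?_ ?_
    · rintro _ ⟨t, ht, rfl⟩
      refine ⟨?_, hmono.monotoneOn ht ⟨hm.1, le_rfl⟩ ht.2⟩
      have := hmono.monotoneOn ⟨le_rfl, hm.1⟩ ht ht.1
      simpa only [hx0] using this
    · have := intermediate_value_Icc hm.1 (hxc.mono hsubm)
      simpa only [hx0] using this
  have hVm : V (z m).1 = y ^ 2 / 2 := by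
    have := hE m hm
    rw [hm0'] at this
    linarith
  have hVlt : ∀ x ∈ Ico 0 (z m).1, V x < y ^ 2 / 2 := by
    intro x hx
    have hx' : x ∈ Icc 0 (z m).1 := Ico_subset_Icc_self hx
    rw [← himage] at hx'
    obtain ⟨t, ht, rfl⟩ := hx'
    have htm : t < m := by
      refine lt_of_le_of_ne ht.2 fun h => ?_
      rw [h] at hx
      exact lt_irrefl _ hx.2
    have h1 := hE t (hsubm ht)
    have h2 := hypos t ⟨ht.1, htm⟩
    have h3 := pow_pos h2 2
    simp only
    linarith
  have hxm : 0 < (z m).1 := hpos m ⟨hmpos, hmlt⟩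
  have hinf : sInf {x | 0 < x ∧ V x = y ^ 2 / 2} = (z m).1 := by
    have : IsLeast {x | 0 < x ∧ V x = y ^ 2 / 2} (z m).1 := by
      refine ⟨⟨hxm, hVm⟩, fun x hx => ?_⟩
      by_contra! hlt
      exact (hVlt x ⟨hx.1.le, hlt⟩).ne hx.2
    exact this.csInf_eq
  -- reversibility
  have htm : t₁ = 2 * m := by
    have hfwd : ∀ s ∈ Icc (0 : ℝ) (min m (t₁ - m)), (z (m + s)).1 = (z (m - s)).1 := by
      have hle : min m (t₁ - m) ≤ m := min_le_left _ _
      have hle' : min m (t₁ - m) ≤ t₁ - m := min_le_right _ _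
      have d1 : ∀ s ∈ Icc (0 : ℝ) (min m (t₁ - m)), HasDerivWithinAt (fun s => z (m + s))
          (potentialField v (z (m + s))) (Icc 0 (min m (t₁ - m))) s := by
        intro s hs
        have haff : HasDerivWithinAt (fun s => m + s) 1 (Icc 0 (min m (t₁ - m))) s :=
          ((hasDerivAt_id s).const_add m).hasDerivWithinAt
        have := (hz (m + s) ⟨by linarith [hs.1], by linarith [hs.2]⟩).scomp s haff
          (fun r hr => ⟨by linarith [hr.1], by linarith [hr.2]⟩)
        rw [one_smul] at this
        exact this
      have d2 : ∀ s ∈ Icc (0 : ℝ) (min m (t₁ - m)),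
          HasDerivWithinAt (fun s => ((z (m - s)).1, -(z (m - s)).2))
          (potentialField v ((z (m - s)).1, -(z (m - s)).2)) (Icc 0 (min m (t₁ - m))) s := by
        intro s hs
        have haff : HasDerivWithinAt (fun s => m - s) (-1) (Icc 0 (min m (t₁ - m))) s :=
          ((hasDerivAt_id s).const_sub m).hasDerivWithinAt
        have h1 := (hz (m - s) ⟨by linarith [hs.2], by linarith [hs.1, hs.2]⟩).scomp s haff
          (fun r hr => ⟨by linarith [hr.2], by linarith [hr.1, hr.2]⟩)
        convert! h1.prod_fst.prodMk h1.prod_snd.neg using 1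
        simp [potentialField]
      have hE := eqOn_Icc_of_hasDerivWithinAt_Ici (contDiff_potentialField hv)
        (fun s hs => (d1 s hs).continuousWithinAt) (fun s hs => (d2 s hs).continuousWithinAt)
        (fun s hs => (d1 s (Ico_subset_Icc_self hs)).Ici_of_Icc hs)
        (fun s hs => (d2 s (Ico_subset_Icc_self hs)).Ici_of_Icc hs)
        (by ext <;> simp [hm0'])
      intro s hs
      have h : z (m + s) = ((z (m - s)).1, -(z (m - s)).2) := hE hs
      rw [h]
    -- If the turning time were not the midpoint, the reflection about it would carry one of the two
    -- ends, where `x = 0`, into the open interval.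
    rcases lt_trichotomy m (t₁ - m) with h | h | h
    · have := hfwd m ⟨hmpos.le, by rw [min_eq_left h.le]⟩
      rw [sub_self, hx0] at this
      have hp := hpos (m + m) ⟨by linarith, by linarith⟩
      linarith
    · linarith
    · have := hfwd (t₁ - m) ⟨by linarith, by rw [min_eq_right h.le]⟩
      rw [add_sub_cancel, hz1] at this
      have hp := hpos (m - (t₁ - m)) ⟨by linarith, by linarith⟩
      simp only at this
      linarith
  -- change of variables
  have himageO : (fun t => (z t).1) '' Ioo 0 m = Ioo 0 (z m).1 := by
    refine Subset.antisymm ?_ ?_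
    · rintro _ ⟨t, ht, rfl⟩
      refine ⟨hpos t ⟨ht.1, ht.2.trans hmlt⟩,
        hmono (Ioo_subset_Icc_self ht) ⟨hm.1, le_rfl⟩ ht.2⟩
    · have := intermediate_value_Ioo hm.1 (hxc.mono hsubm)
      simpa only [hx0] using this
  rw [hinf, intervalIntegral.integral_of_le hxm.le, MeasureTheory.integral_Ioc_eq_integral_Ioo,
    ← himageO, MeasureTheory.integral_image_eq_integral_abs_deriv_smul measurableSet_Ioo
      (fun t ht => (hxd t ht).hasDerivWithinAt) (hmono.injOn.mono Ioo_subset_Icc_self)]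
  -- By conservation of energy the square root is the velocity `dx/dt`, so in the time variable the
  -- integrand is `1`. Working on the open interval avoids the singularity at the turning point.
  have hone : ∀ t ∈ Ioo 0 m,
      |(z t).2| • (1 / √(2 * (y ^ 2 / 2 - V (z t).1))) = (1 : ℝ) := by
    intro t ht
    have hyt := hypos t ⟨ht.1.le, ht.2⟩
    have hEt := hE t (hsubm (Ioo_subset_Icc_self ht))
    have : 2 * (y ^ 2 / 2 - V (z t).1) = (z t).2 ^ 2 := by linarith
    rw [this, Real.sqrt_sq hyt.le, abs_of_pos hyt, smul_eq_mul, mul_one_div, div_self hyt.ne']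
  rw [MeasureTheory.setIntegral_congr_fun measurableSet_Ioo hone]
  simp [hmpos.le, htm]

end HalfPeriod

/-! ### The two half-planes in common coordinates -/

namespace PiecewiseHamiltonian

variable (S : PiecewiseHamiltonian)

/-- Partial derivatives of the data on both sides; the side `x < 0` is rotated to `x > 0` by
`(x, y) ↦ (-x, -y)`. -/
noncomputable def forceP (x : ℝ) : ℝ := deriv S.Vp x

noncomputable def forceM (x : ℝ) : ℝ := -deriv S.Vm (-x)

noncomputable def dxP (u : ℝ × ℝ × ℝ) : ℝ := deriv (fun x => S.H1p x u.2.1 u.2.2) u.1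

noncomputable def dyP (u : ℝ × ℝ × ℝ) : ℝ := deriv (fun y => S.H1p u.1 y u.2.2) u.2.1

noncomputable def dxM (u : ℝ × ℝ × ℝ) : ℝ := -deriv (fun x => S.H1m x (-u.2.1) u.2.2) (-u.1)

noncomputable def dyM (u : ℝ × ℝ × ℝ) : ℝ := -deriv (fun y => S.H1m (-u.1) y u.2.2) (-u.2.1)

end PiecewiseHamiltonian

section Smooth

variable {H : ℝ → ℝ → ℝ → ℝ}

lemma hasDerivAt_uncurry_fst (hH : ContDiff ℝ ∞ fun w : ℝ × ℝ × ℝ => H w.1 w.2.1 w.2.2)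
    (u : ℝ × ℝ × ℝ) : HasDerivAt (fun x => H x u.2.1 u.2.2)
      (fderiv ℝ (fun w : ℝ × ℝ × ℝ => H w.1 w.2.1 w.2.2) u (1, 0, 0)) u.1 :=
  ((hH.differentiable (by simp)) u).hasFDerivAt.comp_hasDerivAt
    (f := fun x : ℝ => (x, u.2.1, u.2.2)) u.1
    ((hasDerivAt_id u.1).prodMk ((hasDerivAt_const u.1 u.2.1).prodMk (hasDerivAt_const u.1 u.2.2)))

lemma hasDerivAt_uncurry_snd (hH : ContDiff ℝ ∞ fun w : ℝ × ℝ × ℝ => H w.1 w.2.1 w.2.2)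
    (u : ℝ × ℝ × ℝ) : HasDerivAt (fun y => H u.1 y u.2.2)
      (fderiv ℝ (fun w : ℝ × ℝ × ℝ => H w.1 w.2.1 w.2.2) u (0, 1, 0)) u.2.1 :=
  ((hH.differentiable (by simp)) u).hasFDerivAt.comp_hasDerivAt
    (f := fun y : ℝ => (u.1, y, u.2.2)) u.2.1
    ((hasDerivAt_const u.2.1 u.1).prodMk ((hasDerivAt_id u.2.1).prodMk
      (hasDerivAt_const u.2.1 u.2.2)))

lemma contDiff_deriv_uncurry_fst (hH : ContDiff ℝ ∞ fun w : ℝ × ℝ × ℝ => H w.1 w.2.1 w.2.2) :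
    ContDiff ℝ 1 fun u : ℝ × ℝ × ℝ => deriv (fun x => H x u.2.1 u.2.2) u.1 := by
  have h : (fun u : ℝ × ℝ × ℝ => deriv (fun x => H x u.2.1 u.2.2) u.1) =
      fun u => fderiv ℝ (fun w : ℝ × ℝ × ℝ => H w.1 w.2.1 w.2.2) u (1, 0, 0) :=
    funext fun u => (hasDerivAt_uncurry_fst hH u).deriv
  rw [h]
  exact (hH.fderiv_right (m := 1) (by norm_cast)).clm_apply contDiff_const

lemma contDiff_deriv_uncurry_snd (hH : ContDiff ℝ ∞ fun w : ℝ × ℝ × ℝ => H w.1 w.2.1 w.2.2) :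
    ContDiff ℝ 1 fun u : ℝ × ℝ × ℝ => deriv (fun y => H u.1 y u.2.2) u.2.1 := by
  have h : (fun u : ℝ × ℝ × ℝ => deriv (fun y => H u.1 y u.2.2) u.2.1) =
      fun u => fderiv ℝ (fun w : ℝ × ℝ × ℝ => H w.1 w.2.1 w.2.2) u (0, 1, 0) :=
    funext fun u => (hasDerivAt_uncurry_snd hH u).deriv
  rw [h]
  exact (hH.fderiv_right (m := 1) (by norm_cast)).clm_apply contDiff_const

lemma contDiff_deriv_of_smooth {V : ℝ → ℝ} (hV : ContDiff ℝ ∞ V) : ContDiff ℝ 1 (deriv V) := by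
  have h : ContDiff ℝ (1 + 1) V := hV.of_le (by norm_cast)
  exact h.deriv'

lemma hamField_mechanical {V : ℝ → ℝ} (hV : ContDiff ℝ ∞ V)
    (hH : ContDiff ℝ ∞ fun w : ℝ × ℝ × ℝ => H w.1 w.2.1 w.2.2) (ε t : ℝ) (z : Plane) :
    hamField (fun x y => (y ^ 2 / 2 + V x) + ε * H x y t) z =
      (z.2 + ε * deriv (fun y => H z.1 y t) z.2,
        -(deriv V z.1 + ε * deriv (fun x => H x z.2 t) z.1)) := by
  have hx := hasDerivAt_uncurry_fst hH (z.1, z.2, t)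
  have hy := hasDerivAt_uncurry_snd hH (z.1, z.2, t)
  have hV' : HasDerivAt V (deriv V z.1) z.1 :=
    ((hV.differentiable (by simp)) z.1).hasDerivAt
  have e1 : HasDerivAt (fun y => (y ^ 2 / 2 + V z.1) + ε * H z.1 y t)
      (z.2 + ε * deriv (fun y => H z.1 y t) z.2) z.2 := by
    have := ((((hasDerivAt_id z.2).pow 2).div_const 2).add_const (V z.1)).add
      (hy.differentiableAt.hasDerivAt.const_mul ε)
    convert! this using 1
    simp
  have e2 : HasDerivAt (fun x => (z.2 ^ 2 / 2 + V x) + ε * H x z.2 t)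
      (deriv V z.1 + ε * deriv (fun x => H x z.2 t) z.1) z.1 :=
    (hV'.const_add _).add (hx.differentiableAt.hasDerivAt.const_mul ε)
  simp only [hamField, e1.deriv, e2.deriv]

lemma hamField_potential {V : ℝ → ℝ} (hV : ContDiff ℝ ∞ V) (z : Plane) :
    hamField (fun x y => y ^ 2 / 2 + V x) z = (z.2, -deriv V z.1) := by
  have := hamField_mechanical hV (H := fun _ _ _ => 0) contDiff_const 0 0 z
  simpa using this

end Smooth

namespace PiecewiseHamiltonian

variable (S : PiecewiseHamiltonian)

lemma contDiff_forceP : ContDiff ℝ 1 S.forceP := contDiff_deriv_of_smooth S.smooth_Vp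

lemma contDiff_forceM : ContDiff ℝ 1 S.forceM :=
  ((contDiff_deriv_of_smooth S.smooth_Vm).comp contDiff_neg).neg

lemma contDiff_dxP : ContDiff ℝ 1 S.dxP := contDiff_deriv_uncurry_fst S.smooth_H1p

lemma contDiff_dyP : ContDiff ℝ 1 S.dyP := contDiff_deriv_uncurry_snd S.smooth_H1p

lemma contDiff_rotation : ContDiff ℝ 1 fun u : ℝ × ℝ × ℝ => (-u.1, -u.2.1, u.2.2) := by fun_prop

lemma contDiff_dxM : ContDiff ℝ 1 S.dxM :=
  ((contDiff_deriv_uncurry_fst S.smooth_H1m).comp contDiff_rotation).neg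

lemma contDiff_dyM : ContDiff ℝ 1 S.dyM :=
  ((contDiff_deriv_uncurry_snd S.smooth_H1m).comp contDiff_rotation).neg

lemma hasDerivAt_Vp (x : ℝ) : HasDerivAt S.Vp (S.forceP x) x :=
  ((S.smooth_Vp.differentiable (by simp)) x).hasDerivAt

lemma hasDerivAt_Vm_neg (x : ℝ) : HasDerivAt (fun x => S.Vm (-x)) (S.forceM x) x := by
  have h := ((S.smooth_Vm.differentiable (by simp)) (-x)).hasDerivAt
  simpa [forceM] using! h.comp x (hasDerivAt_neg x)

lemma fieldP_apply (ε t : ℝ) (z : Plane) : S.fieldP ε t z =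
    (z.2 + ε * S.dyP (z.1, z.2, t), -(S.forceP z.1 + ε * S.dxP (z.1, z.2, t))) :=
  hamField_mechanical S.smooth_Vp S.smooth_H1p ε t z

/-- The rotation by a half turn preserves the Hamiltonian form, so the results on arcs in `x > 0`
also serve the side `x < 0`. -/
lemma fieldM_apply (ε t : ℝ) (z : Plane) : S.fieldM ε t z =
    -((-z).2 + ε * S.dyM ((-z).1, (-z).2, t),
      -(S.forceM (-z).1 + ε * S.dxM ((-z).1, (-z).2, t))) := by
  have := hamField_mechanical S.smooth_Vm S.smooth_H1m ε t z
  refine this.trans ?_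
  ext <;> simp [dyM, dxM, forceM] <;> ring

lemma hamField_H0p (z : Plane) : hamField S.H0p z = potentialField S.forceP z :=
  hamField_potential S.smooth_Vp z

lemma hamField_H0m (z : Plane) : hamField S.H0m z = -potentialField S.forceM (-z) := by
  refine (hamField_potential S.smooth_Vm z).trans ?_
  ext <;> simp [potentialField, forceM]

/-- Arcs in `x > 0`. -/
def ArcP (ε : ℝ) (p p' : ℝ × ℝ) (w : ℝ) : Prop := IsArc S.forceP S.dxP S.dyP ε p p' w

/-- Arcs in `x < 0`, rotated to `x > 0`. -/
def ArcM (ε : ℝ) (p p' : ℝ × ℝ) (w : ℝ) : Prop :=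
  IsArc S.forceM S.dxM S.dyM ε (-p.1, p.2) (-p'.1, p'.2) w

lemma ArcP.impactP {S : PiecewiseHamiltonian} {Φ : PhasePortrait} {ε : ℝ} {p p' : ℝ × ℝ} {w : ℝ}
    (h : S.ArcP ε p p' w) (hp : p.1 < √(2 * Φ.c₁)) (hp' : -√(2 * Φ.c₁) < p'.1) :
    PhasePortrait.ImpactP S Φ ε p p' := by
  obtain ⟨h1, h2, h3, z, hz0, hz1, hpos, hz, -⟩ := h
  refine ⟨⟨h1, hp⟩, ⟨hp', h2⟩, h3, z, hz0, hz1, hpos, fun t ht => ?_⟩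
  rw [fieldP_apply]
  exact hz t ht

lemma ArcM.impactM {S : PiecewiseHamiltonian} {Φ : PhasePortrait} {ε : ℝ} {p p' : ℝ × ℝ} {w : ℝ}
    (h : S.ArcM ε p p' w) (hp : -√(2 * Φ.c₁) < p.1) (hp' : p'.1 < √(2 * Φ.c₁)) :
    PhasePortrait.ImpactM S Φ ε p p' := by
  obtain ⟨h1, h2, h3, z, hz0, hz1, hpos, hz, -⟩ := h
  simp only at h1 h2 h3 hz0 hz1 hpos hz
  refine ⟨⟨hp, by linarith⟩, ⟨by linarith, hp'⟩, h3, fun t => -z t, ?_, ?_, fun t ht => ?_,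
    fun t ht => ?_⟩
  · simp [hz0]
  · simp [hz1]
  · simpa using hpos t ht
  · rw [fieldM_apply, neg_neg]
    exact (hz t ht).neg

/-! ### Solutions of the unperturbed system -/

/-- The region in which the field of `x > 0` is followed forward in time. -/
def rightSide : Set Plane := {z | 0 < z.1 ∨ (z.1 = 0 ∧ 0 < z.2)}

variable {S}

lemma field0_of_mem {z : Plane} (hz : z ∈ rightSide) :
    S.field0 z = potentialField S.forceP z :=
  (if_pos (c := 0 < z.1 ∨ (z.1 = 0 ∧ 0 < z.2)) hz).trans (S.hamField_H0p z)

lemma field0_of_notMem {z : Plane} (hz : z ∉ rightSide) :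
    S.field0 z = -potentialField S.forceM (-z) :=
  (if_neg (c := 0 < z.1 ∨ (z.1 = 0 ∧ 0 < z.2)) hz).trans (S.hamField_H0m z)

lemma IsSolution0.comp_add {q : ℝ → Plane} (hq : S.IsSolution0 q) (s : ℝ) :
    S.IsSolution0 fun t => q (t + s) := by
  refine ⟨hq.1.comp (continuous_add_const s), fun t => ?_⟩
  have := (hq.2 (t + s)).scomp t
    (((hasDerivAt_id t).add_const s).hasDerivWithinAt (s := Ici t))
    (fun r hr => add_le_add_left (mem_Ici.1 hr) s)
  rw [one_smul] at this
  exact this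

/-- Both fields have horizontal velocity `y`; the sign of `y` thus decides the crossing direction
without distinguishing sides. -/
lemma field0_fst (z : Plane) : (S.field0 z).1 = z.2 := by
  by_cases h : z ∈ rightSide
  · rw [field0_of_mem h]; rfl
  · rw [field0_of_notMem h]; simp [potentialField]

/-- Away from the origin a solution stays for a while on the side on which it starts. -/
lemma IsSolution0.eventually_mem_rightSide_iff {q : ℝ → Plane} (hq : S.IsSolution0 q) {t : ℝ}
    (h0 : q t ≠ (0, 0)) : ∀ᶠ s in 𝓝[≥] t, (q s ∈ rightSide ↔ q t ∈ rightSide) := by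
  have hc : ContinuousAt (fun s => (q s).1) t := hq.1.fst.continuousAt
  rcases lt_trichotomy (q t).1 0 with hlt | heq | hgt
  · have h1 : q t ∉ rightSide := by
      rintro (h | h)
      · exact lt_asymm h hlt
      · exact hlt.ne h.1
    filter_upwards [nhdsWithin_le_nhds (hc.eventually (gt_mem_nhds hlt))] with s hs
    refine iff_of_false ?_ h1
    rintro (h | h)
    · exact lt_asymm h hs
    · exact hs.ne h.1
  · have hd := (hq.2 t).prod_fst
    rw [field0_fst] at hd
    have hsl := hasDerivWithinAt_iff_tendsto_slope.1 hd
    rw [Ici_sdiff_left] at hsl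
    have hne : (q t).2 ≠ 0 := fun h => h0 (Prod.ext heq h)
    have hins : 𝓝[≥] t = 𝓝[>] t ⊔ pure t := by
      rw [← Ioi_insert, nhdsWithin_insert, sup_comm]
    rw [hins, eventually_sup]
    refine ⟨?_, by simp⟩
    rcases lt_or_gt_of_ne hne with hneg | hpos
    · filter_upwards [hsl.eventually (gt_mem_nhds hneg), self_mem_nhdsWithin] with s hs hst
      rw [slope_def_field, heq, sub_zero] at hs
      have hst' : t < s := hst
      have : (q s).1 < 0 := by
        by_contra! h
        exact absurd hs (not_lt.2 (div_nonneg h (by linarith)))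
      refine iff_of_false ?_ ?_
      · rintro (h | h)
        · exact lt_asymm h this
        · exact this.ne h.1
      · rintro (h | h)
        · exact h.ne' heq
        · exact lt_asymm h.2 hneg
    · filter_upwards [hsl.eventually (lt_mem_nhds hpos), self_mem_nhdsWithin] with s hs hst
      rw [slope_def_field, heq, sub_zero] at hs
      exact iff_of_true (Or.inl ((div_pos_iff_of_pos_right (sub_pos.2 hst)).1 hs))
        (Or.inr ⟨heq, hpos⟩)
  · filter_upwards [nhdsWithin_le_nhds (hc.eventually (lt_mem_nhds hgt))] with s hs
    exact iff_of_true (Or.inl hs) (Or.inl hgt)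

/-- Forward uniqueness of solutions that do not meet the origin. -/
theorem IsSolution0.eq_of_eq {q₁ q₂ : ℝ → Plane} (h₁ : S.IsSolution0 q₁) (h₂ : S.IsSolution0 q₂)
    {a : ℝ} (ha : q₁ a = q₂ a) (h0 : ∀ t, q₁ t ≠ (0, 0)) : ∀ t, a ≤ t → q₁ t = q₂ t := by
  intro b hab
  have hclosed : IsClosed {t | q₁ t = q₂ t} := isClosed_eq h₁.1 h₂.1
  -- Continuous induction: from a common point other than the origin both solutions follow the same
  -- smooth field for a while, so agreement extends to the right.
  refine (hclosed.inter isClosed_Icc).Icc_subset_of_forall_exists_gt (s := {t | q₁ t = q₂ t}) ha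
    (fun x hx y hxy => ?_) (right_mem_Icc.2 hab)
  have hxe : q₁ x = q₂ x := hx.1
  have e1 := h₁.eventually_mem_rightSide_iff (h0 x)
  have e2 := h₂.eventually_mem_rightSide_iff (t := x) (by rw [← hxe]; exact h0 x)
  obtain ⟨c, hc, hcs⟩ := mem_nhdsGE_iff_exists_Icc_subset.1 (e1.and e2)
  have hcx : x < c := hc
  set d := min c y with hd
  have hxd : x < d := lt_min hc hxy
  have hside : ∀ t ∈ Ico x d, (q₁ t ∈ rightSide ↔ q₁ x ∈ rightSide) ∧
      (q₂ t ∈ rightSide ↔ q₂ x ∈ rightSide) :=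
    fun t ht => hcs ⟨ht.1, ht.2.le.trans (min_le_left _ _)⟩
  refine ⟨d, ?_, hxd, min_le_right _ _⟩
  by_cases hr : q₁ x ∈ rightSide
  · have hr2 : q₂ x ∈ rightSide := by rwa [← hxe]
    exact eqOn_Icc_of_hasDerivWithinAt_Ici (contDiff_potentialField S.contDiff_forceP)
      h₁.1.continuousOn h₂.1.continuousOn
      (fun t ht => by
        rw [← field0_of_mem (((hside t ht).1).2 hr)]; exact h₁.2 t)
      (fun t ht => by
        rw [← field0_of_mem (((hside t ht).2).2 hr2)]; exact h₂.2 t) hxe (right_mem_Icc.2 hxd.le)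
  · have hr2 : q₂ x ∉ rightSide := by rwa [← hxe]
    have hX : ContDiff ℝ 1 fun z : Plane => -potentialField S.forceM (-z) :=
      ((contDiff_potentialField S.contDiff_forceM).comp contDiff_neg).neg
    exact eqOn_Icc_of_hasDerivWithinAt_Ici hX h₁.1.continuousOn h₂.1.continuousOn
      (fun t ht => by
        rw [← field0_of_notMem (fun h => hr (((hside t ht).1).1 h))]; exact h₁.2 t)
      (fun t ht => by
        rw [← field0_of_notMem (fun h => hr2 (((hside t ht).2).1 h))]; exact h₂.2 t) hxe
      (right_mem_Icc.2 hxd.le)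

end PiecewiseHamiltonian

/-! ### Periodic orbits as oscillations, and their period -/

namespace PiecewiseHamiltonian

variable {S : PiecewiseHamiltonian}

/-- `q` is an orbit that leaves `(0, y)` into `x > 0`, comes back to `x = 0` at `(0, -y)` at time
`s`, and then passes through `x < 0` until it closes up at time `τ`. -/
structure IsOscillation (S : PiecewiseHamiltonian) (q : ℝ → Plane) (y s τ : ℝ) : Prop where
  pos : 0 < y
  s_pos : 0 < s
  s_lt : s < τ
  zero_eq : q 0 = (0, y)
  s_eq : q s = (0, -y)
  τ_eq : q τ = (0, y)
  right_pos : ∀ t ∈ Ioo 0 s, 0 < (q t).1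
  left_neg : ∀ t ∈ Ioo s τ, (q t).1 < 0
  right_deriv : ∀ t ∈ Icc 0 s,
    HasDerivWithinAt q (potentialField S.forceP (q t)) (Icc 0 s) t
  left_deriv : ∀ t ∈ Icc s τ,
    HasDerivWithinAt (fun t => -q t) (potentialField S.forceM (-q t)) (Icc s τ) t

/-- The structure of a solution that returns to the positive half of the line `x = 0`. -/
lemma IsSolution0.exists_isOscillation {q : ℝ → Plane} (hq : S.IsSolution0 q) {y p : ℝ}
    (hy : 0 < y) (hp : 0 < p) (hq0 : q 0 = (0, y)) (hqp : q p = (0, y))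
    (hE : ∀ t, (q t).1 = 0 → (q t).2 = y ∨ (q t).2 = -y) :
    ∃ s τ, IsOscillation S q y s τ ∧ τ ≤ p := by
  have hx : Continuous fun t => (q t).1 := hq.1.fst
  have hdx : ∀ t, HasDerivWithinAt (fun t => (q t).1) (q t).2 (Ici t) t := fun t => by
    have := (hq.2 t).prod_fst
    rwa [field0_fst] at this
  obtain ⟨s, hs0, hsp, hxs, hpos⟩ := exists_first_zero hx (a := 0) (by rw [hq0]) (hdx 0)
    (by rw [hq0]; exact hy) hp (by rw [hqp])
  -- At time `s` the field `field0` has already switched to the left side, so the right-hand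
  -- equation is known only before `s` and is extended to the end by continuity.
  have hright : ∀ t ∈ Icc 0 s,
      HasDerivWithinAt q (potentialField S.forceP (q t)) (Icc 0 s) t := by
    refine hasDerivWithinAt_Icc_of_right (contDiff_potentialField S.contDiff_forceP).continuous
      hq.1.continuousOn fun t ht => ?_
    rw [← field0_of_mem (Or.inl (hpos t ht))]
    exact hq.2 t
  -- Energy allows only `±y` on the line, and arriving from `x > 0` rules out a positive velocity.
  have hys : (q s).2 = -y := by
    have h1 : (q s).2 ≤ 0 := nonpos_of_hasDerivWithinAt_of_pos hs0
      ((hright s ⟨hs0.le, le_rfl⟩).prod_fst) hpos hxs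
    rcases hE s hxs with h | h
    · linarith
    · exact h
  have hqs : q s = (0, -y) := Prod.ext hxs hys
  have hsp' : s < p := by
    refine lt_of_le_of_ne hsp fun h => ?_
    rw [h, hqp] at hys
    simp only at hys
    linarith
  obtain ⟨τ, hsτ, hτp, hxτ, hneg⟩ := exists_first_zero hx.neg (a := s) (by simp [hxs])
    (hdx s).neg (by rw [hys]; simpa using hy) hsp' (by simp [hqp])
  have hneg' : ∀ t ∈ Ioo s τ, (q t).1 < 0 := fun t ht => by
    have := hneg t ht
    simp only [Pi.neg_apply] at this
    linarith
  have hxτ' : (q τ).1 = 0 := by simpa using hxτ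
  have hleft : ∀ t ∈ Icc s τ,
      HasDerivWithinAt (fun t => -q t) (potentialField S.forceM (-q t)) (Icc s τ) t := by
    refine hasDerivWithinAt_Icc_of_right (f := fun t => -q t)
      (contDiff_potentialField S.contDiff_forceM).continuous hq.1.neg.continuousOn fun t ht => ?_
    have hmem : q t ∉ rightSide := by
      rintro (h | h)
      · exact lt_asymm h (hneg' t ht)
      · exact (hneg' t ht).ne h.1
    have := (hq.2 t).neg
    rw [field0_of_notMem hmem, neg_neg] at this
    exact this
  have hyτ : (q τ).2 = y := by
    have h1 : (-q τ).2 ≤ 0 := nonpos_of_hasDerivWithinAt_of_pos hsτ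
      ((hleft τ ⟨hsτ.le, le_rfl⟩).prod_fst) hneg (by simp [hxτ'])
    rcases hE τ hxτ' with h | h
    · exact h
    · rw [Prod.snd_neg, h] at h1
      linarith
  exact ⟨s, τ, ⟨hy, hs0, hsτ, hq0, hqs, Prod.ext hxτ' hyτ, hpos, hneg', hright, hleft⟩, hτp⟩

/-- The time of an oscillation, in terms of the integrals `α⁺` and `α⁻`. -/
lemma IsOscillation.alpha_eq {q : ℝ → Plane} {y s τ : ℝ} (h : IsOscillation S q y s τ)
    (hVp : S.Vp 0 = 0) (hVm : S.Vm 0 = 0) : S.alpha y = τ := by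
  have h1 : S.alphaP y = s := two_mul_integral_eq_time S.hasDerivAt_Vp S.contDiff_forceP hVp h.pos
    h.s_pos h.right_deriv h.zero_eq h.s_eq h.right_pos
  have haff : ∀ t, HasDerivAt (fun t : ℝ => t + s) 1 t := fun t => (hasDerivAt_id t).add_const s
  have h2 := two_mul_integral_eq_time (z := fun t => -q (t + s)) (t₁ := τ - s)
    S.hasDerivAt_Vm_neg S.contDiff_forceM (by simp [hVm]) h.pos (sub_pos.2 h.s_lt)
    (fun t ht => by
      have := (h.left_deriv (t + s) ⟨by linarith [ht.1], by linarith [ht.2]⟩).scomp t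
        (haff t).hasDerivWithinAt
        (fun r (hr : r ∈ Icc 0 (τ - s)) => ⟨by linarith [hr.1], by linarith [hr.2]⟩)
      rw [one_smul] at this
      exact this)
    (by simp [h.s_eq]) (by simp [h.τ_eq])
    (fun t ht => by
      have := h.left_neg (t + s) ⟨by linarith [ht.1], by linarith [ht.2]⟩
      simpa using this)
  have h3 : S.alphaM (-y) = τ - s := by
    rw [← h2, alphaM, invVm]
    have hset : {x | x < 0 ∧ S.Vm x = (-y) ^ 2 / 2} =
        -{x | 0 < x ∧ S.Vm (-x) = y ^ 2 / 2} := by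
      ext x
      simp
    rw [hset, Real.sSup_neg, neg_sq,
      intervalIntegral.integral_comp_neg fun x => 1 / √(2 * (y ^ 2 / 2 - S.Vm x)), neg_zero,
      intervalIntegral.integral_symm]
    ring
  rw [alpha, h1, h3]
  ring

lemma energy_of_sectionP {Φ : PhasePortrait} {p : ℝ × ℝ} (hp : p ∈ Φ.sectionP) :
    p.1 ^ 2 / 2 ∈ Ioo 0 Φ.c₁ := by
  have h1 := pow_pos hp.1 2
  have h2 := (Real.lt_sqrt hp.1.le).1 hp.2
  constructor <;> linarith

lemma PhasePortrait.Conditions.Vp_zero {Φ : PhasePortrait} (hΦ : PhasePortrait.Conditions S Φ) :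
    S.Vp 0 = 0 := by
  simpa [H0, H0p] using hΦ.H0_origin

lemma PhasePortrait.Conditions.Vm_zero {Φ : PhasePortrait} (hΦ : PhasePortrait.Conditions S Φ) :
    S.Vm 0 = 0 := by
  rw [← S.V_match, hΦ.Vp_zero]

lemma PhasePortrait.Conditions.H0_line {Φ : PhasePortrait} (hΦ : PhasePortrait.Conditions S Φ)
    {z : Plane} (hz : z.1 = 0) : S.H0 z = z.2 ^ 2 / 2 := by
  simp [H0, H0p, hz, hΦ.Vp_zero]

/-- Energy leaves only `(0, ±y)` as possible crossings, and there are exactly two crossings, so both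
occur. No study of the heteroclinic curve is needed to place them in the region. -/
lemma PhasePortrait.Conditions.mem_Lam {Φ : PhasePortrait} (hΦ : PhasePortrait.Conditions S Φ)
    {y : ℝ} (hy : 0 < y) (hc : y ^ 2 / 2 ∈ Ioo 0 Φ.c₁) :
    ((0, y) : Plane) ∈ PhasePortrait.Lam S Φ (y ^ 2 / 2) := by
  set A : Set Plane := {z ∈ PhasePortrait.Lam S Φ (y ^ 2 / 2) | z.1 = 0} with hA
  have hsub : A ⊆ {(0, y), (0, -y)} := by
    rintro z ⟨⟨-, hz⟩, hz1⟩
    rw [hΦ.H0_line hz1, div_left_inj' two_ne_zero, sq_eq_sq_iff_eq_or_eq_neg] at hz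
    rcases hz with h | h
    · exact Or.inl (Prod.ext hz1 h)
    · exact Or.inr (Prod.ext hz1 h)
  have hne : ((0, y) : Plane) ≠ (0, -y) := fun h => by
    have := congrArg Prod.snd h
    simp only at this
    linarith
  have hcard : ({(0, y), (0, -y)} : Set Plane).ncard = 2 := ncard_pair hne
  have heq : A = {(0, y), (0, -y)} :=
    eq_of_subset_of_ncard_le hsub (by rw [hcard, hΦ.Lam_crosses_twice _ hc])
      ((finite_singleton _).insert _)
  have : ((0, y) : Plane) ∈ A := by rw [heq]; exact Or.inl rfl
  exact this.1

/-- The orbits `Λ_c` are oscillations, whose period is an increasing function of `c`. -/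
theorem PhasePortrait.Conditions.exists_period {Φ : PhasePortrait}
    (hΦ : PhasePortrait.Conditions S Φ) :
    ∃ τ : ℝ → ℝ, (∀ c ∈ Ioo 0 Φ.c₁, 0 < deriv τ c) ∧ ∀ p ∈ Φ.sectionP, ∃ q s,
      S.IsSolution0 q ∧ IsOscillation S q p.1 s (τ (p.1 ^ 2 / 2)) ∧ (∀ t, q t ≠ (0, 0)) ∧
      Function.Periodic q (τ (p.1 ^ 2 / 2)) := by
  obtain ⟨τ, hτ⟩ := hΦ.Lam_periodic
  refine ⟨τ, fun c hc => (hτ c hc).2, fun p hp => ?_⟩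
  have hc := energy_of_sectionP hp
  obtain ⟨⟨Q, hQ, hrange, hleast⟩, -⟩ := hτ _ hc
  obtain ⟨s₀, hs₀⟩ : ((0, p.1) : Plane) ∈ range Q := by
    rw [hrange]; exact hΦ.mem_Lam hp.1 hc
  set q : ℝ → Plane := fun t => Q (t + s₀) with hq
  have hqs : S.IsSolution0 q := hQ.comp_add s₀
  have hperiod : ∀ r, Function.Periodic q r ↔ Function.Periodic Q r := by
    intro r
    refine ⟨fun h t => ?_, fun h t => ?_⟩
    · have := h (t - s₀)
      simp only [hq] at this
      rw [show t - s₀ + r + s₀ = t + r by ring, sub_add_cancel] at this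
      exact this
    · have := h (t + s₀)
      simp only [hq]
      rw [← this]
      congr 1
      ring
  have hleast' : IsLeast {r | 0 < r ∧ Function.Periodic q r} (τ (p.1 ^ 2 / 2)) := by
    simpa only [hperiod] using hleast
  have hH0 : ∀ t, S.H0 (q t) = p.1 ^ 2 / 2 := fun t => by
    have : q t ∈ PhasePortrait.Lam S Φ (p.1 ^ 2 / 2) := by rw [← hrange]; exact ⟨_, rfl⟩
    exact this.2
  have hq00 : ∀ t, q t ≠ (0, 0) := fun t h => by
    have := hH0 t
    rw [h, hΦ.H0_origin] at this
    exact hc.1.ne this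
  have hq0 : q 0 = (0, p.1) := by simp only [hq, zero_add, hs₀]
  have hE : ∀ t, (q t).1 = 0 → (q t).2 = p.1 ∨ (q t).2 = -p.1 := fun t ht => by
    have := hH0 t
    rwa [hΦ.H0_line ht, div_left_inj' two_ne_zero, sq_eq_sq_iff_eq_or_eq_neg] at this
  have hper := hleast'.1.2
  obtain ⟨s, r, hosc, hr⟩ := hqs.exists_isOscillation hp.1 hleast'.1.1 hq0
    (by rw [← hq0]; simpa using hper 0) hE
  have hfwd := (hqs.comp_add r).eq_of_eq hqs (a := 0)
    (by simp only [zero_add]; rw [hosc.τ_eq, hq0]) (fun t => hq00 _)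
  -- Uniqueness holds only forward, for `t ≥ 0`; negative times are reached by adding multiples of
  -- the period already known.
  have hrper : Function.Periodic q r := by
    intro t
    obtain ⟨N, hN⟩ := exists_nat_ge (-t / τ (p.1 ^ 2 / 2))
    have hN' : 0 ≤ t + N * τ (p.1 ^ 2 / 2) := by
      have := (div_le_iff₀ hleast'.1.1).1 hN
      linarith
    have h1 := hfwd _ hN'
    have h2 := hper.nat_mul N
    rw [h2 t, show t + N * τ (p.1 ^ 2 / 2) + r = t + r + N * τ (p.1 ^ 2 / 2) by ring,
      h2 (t + r)] at h1
    exact h1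
  -- Minimality of the period shows that one oscillation is one full period.
  have : r = τ (p.1 ^ 2 / 2) :=
    le_antisymm hr (hleast'.2 ⟨hosc.s_pos.trans hosc.s_lt, hrper⟩)
  exact ⟨q, s, hqs, this ▸ hosc, hq00, hper⟩

/-! ### The bracket along oscillations -/

lemma bracket_of_pos {z : Plane} (hz : 0 < z.1) (t : ℝ) : S.bracketH0H1 z t =
    S.forceP z.1 * S.dyP (z.1, z.2, t) - z.2 * S.dxP (z.1, z.2, t) := by
  have h := hamField_potential S.smooth_Vp z
  simp only [hamField, Prod.mk.injEq] at h
  have h1 : deriv (fun y => S.H0p z.1 y) z.2 = z.2 := h.1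
  have h2 : deriv (fun x => S.H0p x z.2) z.1 = S.forceP z.1 := neg_injective h.2
  rw [bracketH0H1, if_pos hz.le, poissonBracket, h1, h2]
  rfl

lemma bracket_of_neg {z : Plane} (hz : z.1 < 0) (t : ℝ) : S.bracketH0H1 z t =
    S.forceM (-z).1 * S.dyM ((-z).1, (-z).2, t) - (-z).2 * S.dxM ((-z).1, (-z).2, t) := by
  have h := hamField_potential S.smooth_Vm z
  simp only [hamField, Prod.mk.injEq] at h
  have h1 : deriv (fun y => S.H0m z.1 y) z.2 = z.2 := h.1
  have h2 : deriv (fun x => S.H0m x z.2) z.1 = deriv S.Vm z.1 := neg_injective h.2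
  rw [bracketH0H1, if_neg (not_le.2 hz), poissonBracket, h1, h2]
  simp [forceM, dyM, dxM]

/-- Needed because the bracket switches formula on `x = 0`: it equals a continuous integrand only
inside each half turn. -/
lemma intervalIntegrable_of_Ioo {f g : ℝ → ℝ} {a b : ℝ} (hab : a ≤ b)
    (h : ∀ t ∈ Ioo a b, f t = g t) (hg : ContinuousOn g (Icc a b)) :
    IntervalIntegrable f MeasureTheory.volume a b := by
  rw [intervalIntegrable_iff_integrableOn_Ioo_of_le hab]
  refine (hg.integrableOn_Icc.mono_set Ioo_subset_Icc_self).congr_fun (fun t ht => (h t ht).symm)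
    measurableSet_Ioo

/-- The right half of an oscillation is an arc. -/
lemma IsOscillation.arcP {q : ℝ → Plane} {y s τ : ℝ} (h : IsOscillation S q y s τ) (t : ℝ) :
    S.ArcP 0 (y, t) (-y, t + s) (∫ σ in (0 : ℝ)..s, S.bracketH0H1 (q σ) (σ + t)) ∧
      IntervalIntegrable (fun σ => S.bracketH0H1 (q σ) (σ + t)) MeasureTheory.volume 0 s := by
  have htraj : IsTrajectory S.forceP S.dxP S.dyP 0 (fun r => q (r - t)) t (t + s) := by
    rw [isTrajectory_zero_iff]
    intro r hr
    have := (h.right_deriv (r - t) ⟨by linarith [hr.1], by linarith [hr.2]⟩).scomp r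
      ((hasDerivAt_id r).sub_const t).hasDerivWithinAt
      (fun r' (hr' : r' ∈ Icc t (t + s)) => ⟨by simpa using hr'.1, by
        have := hr'.2
        simp only [id]
        linarith⟩)
    rw [one_smul] at this
    exact this
  have hcong : ∀ σ ∈ Ioo 0 s, S.bracketH0H1 (q σ) (σ + t) =
      powerAlong S.forceP S.dxP S.dyP (fun r => q (r - t)) (σ + t) := fun σ hσ => by
    rw [bracket_of_pos (h.right_pos σ hσ)]
    simp [powerAlong]
  refine ⟨⟨h.pos, by simpa using h.pos, by simpa using h.s_pos, fun r => q (r - t), ?_, ?_, ?_,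
    htraj, ?_⟩, ?_⟩
  · simp [h.zero_eq]
  · simp [h.s_eq]
  · intro r hr
    exact h.right_pos _ ⟨by linarith [hr.1], by linarith [hr.2]⟩
  · rw [intervalIntegral.integral_congr_Ioo_of_le h.s_pos.le hcong, intervalIntegral.integral_comp_add_right
      (powerAlong S.forceP S.dxP S.dyP fun r => q (r - t)), zero_add, add_comm s t]
  · refine intervalIntegrable_of_Ioo h.s_pos.le hcong ?_
    have hc := htraj.continuousOn_powerAlong S.contDiff_forceP.continuous
      S.contDiff_dxP.continuous S.contDiff_dyP.continuous
    exact hc.comp (continuous_add_const t).continuousOn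
      fun σ hσ => ⟨by linarith [hσ.1], by linarith [hσ.2]⟩

/-- The left half of an oscillation is an arc. -/
lemma IsOscillation.arcM {q : ℝ → Plane} {y s τ : ℝ} (h : IsOscillation S q y s τ) (t : ℝ) :
    S.ArcM 0 (-y, t + s) (y, t + τ) (∫ σ in s..τ, S.bracketH0H1 (q σ) (σ + t)) ∧
      IntervalIntegrable (fun σ => S.bracketH0H1 (q σ) (σ + t)) MeasureTheory.volume s τ := by
  have htraj : IsTrajectory S.forceM S.dxM S.dyM 0 (fun r => -q (r - t)) (t + s) (t + τ) := by
    rw [isTrajectory_zero_iff]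
    intro r hr
    have := (h.left_deriv (r - t) ⟨by linarith [hr.1], by linarith [hr.2]⟩).scomp r
      ((hasDerivAt_id r).sub_const t).hasDerivWithinAt
      (fun r' (hr' : r' ∈ Icc (t + s) (t + τ)) => ⟨by
        have := hr'.1
        simp only [id]
        linarith, by
        have := hr'.2
        simp only [id]
        linarith⟩)
    rw [one_smul] at this
    exact this
  have hcong : ∀ σ ∈ Ioo s τ, S.bracketH0H1 (q σ) (σ + t) =
      powerAlong S.forceM S.dxM S.dyM (fun r => -q (r - t)) (σ + t) := fun σ hσ => by
    rw [bracket_of_neg (h.left_neg σ hσ)]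
    simp [powerAlong]
  have hlt := h.s_lt
  refine ⟨⟨by simpa using h.pos, by simpa using h.pos, by simpa using hlt,
    fun r => -q (r - t), ?_, ?_, ?_, htraj, ?_⟩, ?_⟩
  · simp [h.s_eq]
  · simp [h.τ_eq]
  · intro r hr
    have := h.left_neg (r - t) ⟨by linarith [hr.1], by linarith [hr.2]⟩
    simpa using this
  · rw [intervalIntegral.integral_congr_Ioo_of_le hlt.le hcong, intervalIntegral.integral_comp_add_right
      (powerAlong S.forceM S.dxM S.dyM fun r => -q (r - t)), add_comm s t, add_comm τ t]
  · refine intervalIntegrable_of_Ioo hlt.le hcong ?_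
    have hc := htraj.continuousOn_powerAlong S.contDiff_forceM.continuous
      S.contDiff_dxM.continuous S.contDiff_dyM.continuous
    exact hc.comp (continuous_add_const t).continuousOn
      fun σ hσ => ⟨by linarith [hσ.1], by linarith [hσ.2]⟩

end PiecewiseHamiltonian

/-! ### Germs of the impact map and of its iterates -/

/-- `f` has some strict derivative at `x`. -/
def StrictlyDifferentiableAt {E F : Type*} [NormedAddCommGroup E] [NormedSpace ℝ E]
    [NormedAddCommGroup F] [NormedSpace ℝ F] (f : E → F) (x : E) : Prop :=
  ∃ L : E →L[ℝ] F, HasStrictFDerivAt f L x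

namespace StrictlyDifferentiableAt

variable {E F G : Type*} [NormedAddCommGroup E] [NormedSpace ℝ E] [NormedAddCommGroup F]
  [NormedSpace ℝ F] [NormedAddCommGroup G] [NormedSpace ℝ G] {f : E → F} {x : E}

lemma of_contDiff (h : ContDiff ℝ 1 f) : StrictlyDifferentiableAt f x :=
  ⟨_, h.contDiffAt.hasStrictFDerivAt one_ne_zero⟩

lemma comp {g : F → G} (hg : StrictlyDifferentiableAt g (f x)) (hf : StrictlyDifferentiableAt f x) :
    StrictlyDifferentiableAt (fun y => g (f y)) x := by
  obtain ⟨L, hL⟩ := hg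
  obtain ⟨M, hM⟩ := hf
  exact ⟨_, HasStrictFDerivAt.comp (g := g) x hL hM⟩

lemma prodMk {g : E → G} (hf : StrictlyDifferentiableAt f x) (hg : StrictlyDifferentiableAt g x) :
    StrictlyDifferentiableAt (fun y => (f y, g y)) x := by
  obtain ⟨L, hL⟩ := hg
  obtain ⟨M, hM⟩ := hf
  exact ⟨_, hM.prodMk hL⟩

lemma continuousAt (hf : StrictlyDifferentiableAt f x) : ContinuousAt f x := by
  obtain ⟨L, hL⟩ := hf
  exact hL.continuousAt

end StrictlyDifferentiableAt

namespace PiecewiseHamiltonian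

variable {S : PiecewiseHamiltonian}

/-- The germ at an unperturbed oscillation of the dissipative impact map, together with the
coefficients `A`, `B` of the energy balance `y'² / 2 = y² / 2 + ε A + (1 - r) B`. The variables are
`(y, t, ε, 1 - r)` and the values `(y', t', A, B)`. -/
theorem exists_impactGerm {Φ : PhasePortrait} {τ : ℝ → ℝ}
    (hτ : ∀ p ∈ Φ.sectionP, ∃ q s, S.IsSolution0 q ∧ IsOscillation S q p.1 s (τ (p.1 ^ 2 / 2)) ∧
      (∀ t, q t ≠ (0, 0)) ∧ Function.Periodic q (τ (p.1 ^ 2 / 2)))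
    {q : ℝ → Plane} {y₀ s₀ t₀ : ℝ} (hy₀ : y₀ < √(2 * Φ.c₁))
    (hq : IsOscillation S q y₀ s₀ (τ (y₀ ^ 2 / 2))) :
    ∃ G : ℝ × ℝ × ℝ × ℝ → ℝ × ℝ × ℝ × ℝ, StrictlyDifferentiableAt G (y₀, t₀, 0, 0) ∧
      (G (y₀, t₀, 0, 0)).1 = y₀ ∧ (G (y₀, t₀, 0, 0)).2.1 = t₀ + τ (y₀ ^ 2 / 2) ∧
      ∀ᶠ p in 𝓝 (y₀, t₀, (0 : ℝ), (0 : ℝ)),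
        PhasePortrait.DissipativeImpactMap S Φ p.2.2.1 (1 - p.2.2.2) (p.1, p.2.1)
          ((G p).1, (G p).2.1) ∧
        (G p).1 ^ 2 / 2 = p.1 ^ 2 / 2 + p.2.2.1 * (G p).2.2.1 + p.2.2.2 * (G p).2.2.2 ∧
        (p.2.2.1 = 0 → p.2.2.2 = 0 → (G p).1 = p.1 ∧ (G p).2.1 = p.2.1 + τ (p.1 ^ 2 / 2) ∧
          (p.1 = y₀ → (G p).2.2.1 =
            ∫ σ in (0 : ℝ)..τ (y₀ ^ 2 / 2), S.bracketH0H1 (q σ) (σ + p.2.1))) := by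
  obtain ⟨P, LP, hP, hP0, hPev⟩ := exists_arcMap_hasStrictFDerivAt S.contDiff_forceP S.contDiff_dxP
    S.contDiff_dyP (hq.arcP t₀).1
  obtain ⟨M, LM, hM, hM0, hMev⟩ := exists_arcMap_hasStrictFDerivAt S.contDiff_forceM S.contDiff_dxM
    S.contDiff_dyM (hq.arcM t₀).1
  simp only [neg_neg] at hM hM0 hMev
  set b : ℝ × ℝ × ℝ × ℝ := (y₀, t₀, 0, 0) with hb
  set pre : ℝ × ℝ × ℝ × ℝ → ℝ × ℝ × ℝ := fun p => (p.1, p.2.1, p.2.2.1) with hpre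
  -- The first impact followed by the rotation: the velocity is scaled by `r` and changes sign.
  set mid : (ℝ × ℝ × ℝ) × (ℝ × ℝ × ℝ × ℝ) → ℝ × ℝ × ℝ :=
    fun r => (-((1 - r.2.2.2.2) * r.1.1), r.1.2.1, r.2.2.2.1) with hmid
  -- With `σ = 1 - r`, an impact at speed `u` costs `(1 - r²) u²/2 = σ (2 - σ) u²/2`; the last entry
  -- is minus the sum of the two losses divided by `σ`, and the third adds the two works.
  set post : (ℝ × ℝ × ℝ) × (ℝ × ℝ × ℝ) × (ℝ × ℝ × ℝ × ℝ) → ℝ × ℝ × ℝ × ℝ :=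
    fun r => ((1 - r.2.2.2.2.2) * -r.1.1, r.1.2.1, r.2.1.2.2 + r.1.2.2,
      -(2 - r.2.2.2.2.2) / 2 * (r.2.1.1 ^ 2 + r.1.1 ^ 2)) with hpost
  have hpred : StrictlyDifferentiableAt pre b := .of_contDiff (by simp only [hpre]; fun_prop)
  set g₁ : ℝ × ℝ × ℝ × ℝ → (ℝ × ℝ × ℝ) × (ℝ × ℝ × ℝ × ℝ) := fun p => (P (pre p), p) with hg₁
  have hg₁d : StrictlyDifferentiableAt g₁ b :=
    (StrictlyDifferentiableAt.comp (g := P) (f := pre) (x := b) ⟨LP, hP⟩ hpred).prodMk (.of_contDiff contDiff_id)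
  have hg₁b : g₁ b = ((-y₀, t₀ + s₀, _), b) := Prod.ext hP0 rfl
  have hmidd : StrictlyDifferentiableAt (fun p => mid (g₁ p)) b :=
    StrictlyDifferentiableAt.comp (g := mid)
      (.of_contDiff (by simp only [hmid]; fun_prop)) hg₁d
  have hmidb : mid (g₁ b) = (y₀, t₀ + s₀, 0) := by
    rw [hg₁b]; simp [hmid, hb]
  set Q : ℝ × ℝ × ℝ × ℝ → ℝ × ℝ × ℝ := fun p => M (mid (g₁ p)) with hQ
  have hQd : StrictlyDifferentiableAt Q b :=
    StrictlyDifferentiableAt.comp (g := M) (by rw [hmidb]; exact ⟨LM, hM⟩) hmidd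
  have hQb : (Q b).1 = -y₀ := by simp only [hQ, hmidb, hM0]
  have hQb' : (Q b).2.1 = t₀ + τ (y₀ ^ 2 / 2) := by simp only [hQ, hmidb, hM0]
  set G : ℝ × ℝ × ℝ × ℝ → ℝ × ℝ × ℝ × ℝ := fun p => post (Q p, g₁ p) with hG
  have hGd : StrictlyDifferentiableAt G b :=
    StrictlyDifferentiableAt.comp (g := post)
      (.of_contDiff (by simp only [hpost]; fun_prop)) (hQd.prodMk hg₁d)
  refine ⟨G, hGd, ?_, ?_, ?_⟩
  · change (1 - (g₁ b).2.2.2.2) * -(Q b).1 = y₀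
    rw [hg₁b, hQb]
    simp [hb]
  · simp only [hG, hQb', hpost]
  · have c1 : ContinuousAt (fun p => (P (pre p)).1) b := hg₁d.continuousAt.fst.fst
    have c2 : ContinuousAt (fun p : ℝ × ℝ × ℝ × ℝ => (1 - p.2.2.2) * (P (pre p)).1) b :=
      (by fun_prop : Continuous fun p : ℝ × ℝ × ℝ × ℝ => 1 - p.2.2.2).continuousAt.mul c1
    have c3 : ContinuousAt (fun p => -(Q p).1) b := hQd.continuousAt.fst.neg
    have b1 : (P (pre b)).1 = -y₀ := by
      have := congrArg Prod.fst (congrArg Prod.fst hg₁b)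
      exact this
    have e1 : ∀ᶠ p in 𝓝 b, -√(2 * Φ.c₁) < (P (pre p)).1 :=
      c1.eventually (lt_mem_nhds (by simp only [b1]; linarith))
    have e2 : ∀ᶠ p in 𝓝 b, -√(2 * Φ.c₁) < (1 - p.2.2.2) * (P (pre p)).1 :=
      c2.eventually (lt_mem_nhds (by
        change -√(2 * Φ.c₁) < (1 - (0 : ℝ)) * (P (pre b)).1
        rw [b1]
        linarith))
    have e3 : ∀ᶠ p in 𝓝 b, -(Q p).1 < √(2 * Φ.c₁) :=
      c3.eventually (gt_mem_nhds (by simp only [hQb]; linarith))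
    have e4 : ∀ᶠ p in 𝓝 b, p.1 < √(2 * Φ.c₁) :=
      continuous_fst.continuousAt.eventually (gt_mem_nhds hy₀)
    have e5 : ∀ᶠ p in 𝓝 b, S.ArcP p.2.2.1 (p.1, p.2.1) ((P (pre p)).1, (P (pre p)).2.1)
        (P (pre p)).2.2 := hpred.continuousAt.eventually hPev
    have e6 : ∀ᶠ p in 𝓝 b, S.ArcM p.2.2.1 ((1 - p.2.2.2) * (P (pre p)).1, (P (pre p)).2.1)
        (-(Q p).1, (Q p).2.1) (Q p).2.2 := by
      have hc : Tendsto (fun p => mid (g₁ p)) (𝓝 b) (𝓝 (y₀, t₀ + s₀, 0)) := by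
        have := hmidd.continuousAt
        rwa [ContinuousAt, hmidb] at this
      filter_upwards [hc.eventually hMev] with p hp
      simp only [ArcM, neg_neg]
      exact hp
    filter_upwards [e1, e2, e3, e4, e5, e6] with p h1 h2 h3 h4 h5 h6
    refine ⟨⟨_, _, h5.impactP h4 h1, h6.impactM h2 h3, rfl⟩, ?_, fun hε hs => ?_⟩
    · have E1 := IsArc.energy S.hasDerivAt_Vp S.contDiff_forceP.continuous
        S.contDiff_dxP.continuous S.contDiff_dyP.continuous h5
      have E2 := IsArc.energy S.hasDerivAt_Vm_neg S.contDiff_forceM.continuous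
        S.contDiff_dxM.continuous S.contDiff_dyM.continuous h6
      simp only [neg_neg] at E1 E2
      simp only [hG, hpost, hg₁]
      linear_combination (1 - p.2.2.2 * (2 - p.2.2.2)) * E2 + p.2.2.2 * (2 - p.2.2.2) * E2 + E1
    -- Without perturbation and loss, uniqueness of arcs identifies the germ with any oscillation
    -- through the point. At general `y` one is supplied by `hτ`; at `y₀` the given `q` itself is
    -- used, so that the work is its bracket integral.
    · have key : ∀ {q' : ℝ → Plane} {s' : ℝ}, IsOscillation S q' p.1 s' (τ (p.1 ^ 2 / 2)) →
          (G p).1 = p.1 ∧ (G p).2.1 = p.2.1 + τ (p.1 ^ 2 / 2) ∧ (G p).2.2.1 =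
            ∫ σ in (0 : ℝ)..τ (p.1 ^ 2 / 2), S.bracketH0H1 (q' σ) (σ + p.2.1) := by
        intro q' s' hosc
        rw [hε] at h5 h6
        obtain ⟨a1, a2⟩ := h5.unique_zero S.contDiff_forceP (hosc.arcP p.2.1).1
        obtain ⟨a3, a4⟩ := Prod.ext_iff.1 a1
        simp only at a3 a4
        rw [hs, sub_zero, one_mul, a3, a4] at h6
        obtain ⟨a5, a6⟩ := h6.unique_zero S.contDiff_forceM (hosc.arcM p.2.1).1
        obtain ⟨a7, a8⟩ := Prod.ext_iff.1 a5
        simp only [neg_neg] at a7 a8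
        refine ⟨?_, ?_, ?_⟩
        · simp only [hG, hpost, hg₁, hs, a7]; ring
        · simp only [hG, hpost, a8]
        · simp only [hG, hpost, hg₁, a2, a6]
          exact intervalIntegral.integral_add_adjacent_intervals (hosc.arcP p.2.1).2
            (hosc.arcM p.2.1).2
      have hmem : ((p.1, p.2.1) : ℝ × ℝ) ∈ Φ.sectionP := ⟨h5.1, h4⟩
      obtain ⟨q', s', -, hosc, -⟩ := hτ _ hmem
      refine ⟨(key hosc).1, (key hosc).2.1, fun hy => ?_⟩
      rw [← hy] at hq ⊢
      exact (key hq).2.2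

/-- The germ of the iterates of the dissipative impact map. -/
theorem exists_iterateGerm {Φ : PhasePortrait} {τ : ℝ → ℝ}
    (hτ : ∀ p ∈ Φ.sectionP, ∃ q s, S.IsSolution0 q ∧ IsOscillation S q p.1 s (τ (p.1 ^ 2 / 2)) ∧
      (∀ t, q t ≠ (0, 0)) ∧ Function.Periodic q (τ (p.1 ^ 2 / 2)))
    {q : ℝ → Plane} {y₀ s₀ t₀ : ℝ} (hy₀ : y₀ < √(2 * Φ.c₁))
    (hq : IsOscillation S q y₀ s₀ (τ (y₀ ^ 2 / 2))) (k : ℕ) :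
    ∃ G : ℝ × ℝ × ℝ × ℝ → ℝ × ℝ × ℝ × ℝ, StrictlyDifferentiableAt G (y₀, t₀, 0, 0) ∧
      (G (y₀, t₀, 0, 0)).1 = y₀ ∧ (G (y₀, t₀, 0, 0)).2.1 = t₀ + k * τ (y₀ ^ 2 / 2) ∧
      ∀ᶠ p in 𝓝 (y₀, t₀, (0 : ℝ), (0 : ℝ)),
        iterateGraph (PhasePortrait.DissipativeImpactMap S Φ p.2.2.1 (1 - p.2.2.2)) k (p.1, p.2.1)
          ((G p).1, (G p).2.1) ∧
        (G p).1 ^ 2 / 2 = p.1 ^ 2 / 2 + p.2.2.1 * (G p).2.2.1 + p.2.2.2 * (G p).2.2.2 ∧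
        (p.2.2.1 = 0 → p.2.2.2 = 0 → (G p).1 = p.1 ∧ (G p).2.1 = p.2.1 + k * τ (p.1 ^ 2 / 2) ∧
          (p.1 = y₀ → (G p).2.2.1 = ∑ i ∈ Finset.range k,
            ∫ σ in (0 : ℝ)..τ (y₀ ^ 2 / 2),
              S.bracketH0H1 (q σ) (σ + (p.2.1 + i * τ (y₀ ^ 2 / 2))))) := by
  induction k with
  | zero =>
    refine ⟨fun p => (p.1, p.2.1, 0, 0), .of_contDiff (by fun_prop), rfl, by simp,
      Eventually.of_forall fun p => ⟨rfl, by simp, fun _ _ => by simp⟩⟩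
  | succ k ih =>
    obtain ⟨G, hGd, hG1, hG2, hGev⟩ := ih
    -- The next germ is centred where `k` unperturbed turns end. The energy balances of successive
    -- turns telescope, so the coefficients `A` and `B` simply add.
    obtain ⟨N, hNd, hN1, hN2, hNev⟩ :=
      exists_impactGerm hτ (t₀ := t₀ + k * τ (y₀ ^ 2 / 2)) hy₀ hq
    set b : ℝ × ℝ × ℝ × ℝ := (y₀, t₀, 0, 0) with hb
    set mid : ℝ × ℝ × ℝ × ℝ → ℝ × ℝ × ℝ × ℝ :=
      fun p => ((G p).1, (G p).2.1, p.2.2.1, p.2.2.2) with hmid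
    have hmidd : StrictlyDifferentiableAt mid b :=
      StrictlyDifferentiableAt.comp
        (g := fun r : (ℝ × ℝ × ℝ × ℝ) × (ℝ × ℝ × ℝ × ℝ) => (r.1.1, r.1.2.1, r.2.2.2.1, r.2.2.2.2))
        (.of_contDiff (by fun_prop)) (hGd.prodMk (.of_contDiff contDiff_id))
    have hmidb : mid b = (y₀, t₀ + k * τ (y₀ ^ 2 / 2), 0, 0) :=
      Prod.ext hG1 (Prod.ext hG2 rfl)
    have hNmid : StrictlyDifferentiableAt (fun p => N (mid p)) b :=
      StrictlyDifferentiableAt.comp (by rw [hmidb]; exact hNd) hmidd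
    have hmidc : Tendsto mid (𝓝 b) (𝓝 (y₀, t₀ + k * τ (y₀ ^ 2 / 2), 0, 0)) := by
      rw [← hmidb]; exact hmidd.continuousAt
    refine ⟨fun p => ((N (mid p)).1, (N (mid p)).2.1, (G p).2.2.1 + (N (mid p)).2.2.1,
        (G p).2.2.2 + (N (mid p)).2.2.2),
      StrictlyDifferentiableAt.comp
        (g := fun r : (ℝ × ℝ × ℝ × ℝ) × (ℝ × ℝ × ℝ × ℝ) =>
          (r.1.1, r.1.2.1, r.2.2.2.1 + r.1.2.2.1, r.2.2.2.2 + r.1.2.2.2))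
        (.of_contDiff (by fun_prop)) (hNmid.prodMk hGd), ?_, ?_, ?_⟩
    · simp only [hmidb, hN1]
    · simp only [hmidb, hN2]
      push_cast
      ring
    · filter_upwards [hGev, hmidc.eventually hNev] with p hp hp'
      obtain ⟨h1, h2, h3⟩ := hp
      obtain ⟨h4, h5, h6⟩ := hp'
      refine ⟨⟨_, h1, h4⟩, ?_, fun hε hs => ?_⟩
      · simp only [hmid] at h5 ⊢
        linear_combination h2 + h5
      · obtain ⟨a1, a2, a3⟩ := h3 hε hs
        obtain ⟨a4, a5, a6⟩ := h6 hε hs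
        have m1 : (mid p).1 = p.1 := a1
        have m2 : (mid p).2.1 = p.2.1 + k * τ (p.1 ^ 2 / 2) := a2
        rw [m1] at a4 a5 a6
        rw [m2] at a5 a6
        refine ⟨a4, ?_, fun hy => ?_⟩
        · rw [a5]
          push_cast
          ring
        · rw [Finset.sum_range_succ, ← a3 hy, a6 hy, hy]

/-- The Melnikov function as a sum over the periods of the unperturbed orbit. -/
lemma sum_integral_eq_melnikov {q Q : ℝ → Plane} {y s τ t : ℝ} (hQ : IsOscillation S Q y s τ)
    (hper : Function.Periodic Q τ) (hqQ : ∀ t, 0 ≤ t → q t = Q t) {n m : ℕ}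
    (hnm : m * τ = n * S.T) :
    ∑ i ∈ Finset.range m, ∫ σ in (0 : ℝ)..τ, S.bracketH0H1 (Q σ) (σ + (t + i * τ)) =
      S.melnikov q n t := by
  have hτ0 : 0 < τ := hQ.s_pos.trans hQ.s_lt
  have hshift : ∀ i : ℕ, ∀ σ, S.bracketH0H1 (Q σ) (σ + (t + i * τ)) =
      S.bracketH0H1 (Q (σ + i * τ)) ((σ + i * τ) + t) := fun i σ => by
    rw [hper.nat_mul i σ]
    congr 1
    ring
  have hint : ∀ i : ℕ, IntervalIntegrable (fun σ => S.bracketH0H1 (Q σ) (σ + t))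
      MeasureTheory.volume (i * τ) ((i + 1 : ℕ) * τ) := by
    intro i
    have h1 := ((hQ.arcP (t + i * τ)).2.trans (hQ.arcM (t + i * τ)).2).comp_sub_right (i * τ)
    simp only [hshift i, sub_add_cancel] at h1
    convert h1 using 1
    · ring
    · push_cast; ring
  rw [melnikov, ← hnm]
  have h2 := intervalIntegral.sum_integral_adjacent_intervals (a := fun i : ℕ => (i : ℝ) * τ)
    (n := m) (fun i _ => hint i)
  simp only [Nat.cast_zero, zero_mul] at h2
  -- `q` and the periodic orbit `Q` need agree only for nonnegative times, and the Melnikov integral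
  -- uses no others.
  rw [intervalIntegral.integral_congr (g := fun σ => S.bracketH0H1 (Q σ) (σ + t)) (fun σ hσ => ?_),
    ← h2]
  · refine Finset.sum_congr rfl fun i _ => ?_
    simp only [hshift i]
    rw [intervalIntegral.integral_comp_add_right (fun σ => S.bracketH0H1 (Q σ) (σ + t)), zero_add]
    push_cast
    congr 1
    ring
  · rw [uIcc_of_le (by positivity)] at hσ
    simp only [hqQ σ hσ.1]

end PiecewiseHamiltonian

namespace PiecewiseHamiltonian

variable {S : PiecewiseHamiltonian}

lemma iterateGraph_mono {R R' : ℝ × ℝ → ℝ × ℝ → Prop} (h : ∀ p p', R p p' → R' p p') :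
    ∀ {k : ℕ} {p p' : ℝ × ℝ}, iterateGraph R k p p' → iterateGraph R' k p p'
  | 0, _, _, hp => hp
  | _ + 1, _, _, ⟨a, ha, hap⟩ => ⟨a, iterateGraph_mono h ha, h _ _ hap⟩

/-- Restitution with `r = 1` is the identity, so the conservative orbits are the slice `κ = 0` of
the dissipative branch. -/
lemma SolvesDissipative.solvesConservative {Φ : PhasePortrait} {n m : ℕ} {ε : ℝ} {p : ℝ × ℝ}
    (h : S.SolvesDissipative Φ n m ε 1 p) : S.SolvesConservative Φ n m ε p := by
  refine iterateGraph_mono ?_ h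
  rintro p p' ⟨a, b, ha, hb, rfl⟩
  simp only [PhasePortrait.restitution, one_mul] at hb ⊢
  exact ⟨a, ha, hb⟩

end PiecewiseHamiltonian

/-! ### The branch of periodic orbits -/

/-- The implicit function theorem in the plane, for a partial derivative in triangular form. -/
theorem StrictlyDifferentiableAt.exists_implicit_branch {F : (ℝ × ℝ) × (ℝ × ℝ) → ℝ × ℝ}
    {x₀ u₀ : ℝ × ℝ} (hF : StrictlyDifferentiableAt F (x₀, u₀)) (hF0 : F (x₀, u₀) = 0)
    {a d : ℝ} (ha : a ≠ 0) (hd : d ≠ 0)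
    (h1 : HasDerivAt (fun y => (F (x₀, (y, u₀.2))).1) a u₀.1)
    (h2 : HasDerivAt (fun t => F (x₀, (u₀.1, t))) (0, d) u₀.2) :
    ∃ ψ : ℝ × ℝ → ℝ × ℝ, StrictlyDifferentiableAt ψ x₀ ∧ ψ x₀ = u₀ ∧
      ∀ᶠ x in 𝓝 x₀, F (x, ψ x) = 0 := by
  obtain ⟨L, hL⟩ := hF
  set L₂ : ℝ × ℝ →L[ℝ] ℝ × ℝ := L.comp (ContinuousLinearMap.inr ℝ (ℝ × ℝ) (ℝ × ℝ)) with hL₂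
  have e1 : (L₂ (1, 0)).1 = a := by
    have h : HasDerivAt (fun y : ℝ => (x₀, (y, u₀.2))) ((0 : ℝ × ℝ), ((1 : ℝ), (0 : ℝ))) u₀.1 :=
      (hasDerivAt_const _ _).prodMk ((hasDerivAt_id _).prodMk (hasDerivAt_const _ _))
    have := HasFDerivAt.comp_hasDerivAt (f := fun y : ℝ => (x₀, (y, u₀.2))) u₀.1 hL.hasFDerivAt h
    exact (hasFDerivAt_fst.comp_hasDerivAt _ this).unique h1
  have e2 : L₂ (0, 1) = (0, d) := by
    have : HasDerivAt (fun t : ℝ => (x₀, (u₀.1, t))) ((0 : ℝ × ℝ), ((0 : ℝ), (1 : ℝ))) u₀.2 :=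
      (hasDerivAt_const _ _).prodMk ((hasDerivAt_const _ _).prodMk (hasDerivAt_id _))
    exact (HasFDerivAt.comp_hasDerivAt (f := fun t : ℝ => (x₀, (u₀.1, t))) u₀.2 hL.hasFDerivAt
      this).unique h2
  -- The entry `c`, here the variation of the work with `y`, stays unknown; a triangular matrix is
  -- invertible whatever it is.
  obtain ⟨c, e1'⟩ : ∃ c, L₂ (1, 0) = (a, c) := ⟨_, Prod.ext e1 rfl⟩
  have e : ∀ v : ℝ × ℝ, L₂ v = (v.1 * a, v.1 * c + v.2 * d) := fun v => by
    have : v = v.1 • ((1 : ℝ), (0 : ℝ)) + v.2 • ((0 : ℝ), (1 : ℝ)) := by ext <;> simp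
    conv_lhs => rw [this]
    rw [map_add, map_smul, map_smul, e1', e2]
    ext <;> simp
  have hinv : L₂.IsInvertible := by
    refine ContinuousLinearMap.IsInvertible.of_inverse
      (g := (a⁻¹ • ContinuousLinearMap.fst ℝ ℝ ℝ).prod
        (d⁻¹ • (ContinuousLinearMap.snd ℝ ℝ ℝ - (c * a⁻¹) • ContinuousLinearMap.fst ℝ ℝ ℝ)))
      (ContinuousLinearMap.ext fun v => Prod.ext ?_ ?_)
      (ContinuousLinearMap.ext fun v => Prod.ext ?_ ?_) <;>
    simp [e] <;> field_simp <;> ring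
  refine ⟨hL.implicitFunctionOfProdDomain hinv, ⟨_,
    hL.hasStrictFDerivAt_implicitFunctionOfProdDomain hinv⟩,
    (hL.eventually_apply_eq_iff_implicitFunctionOfProdDomain hinv).self_of_nhds.1 rfl, ?_⟩
  filter_upwards [hL.eventually_apply_implicitFunctionOfProdDomain hinv] with x hx
  rw [hx, hF0]

namespace PiecewiseHamiltonian

/-- The branch of `(n, m)`-periodic orbits, parametrized by `ε` and `κ = (1 - r) / ε`. -/
theorem exists_branch {Φ : PhasePortrait} (hΦ : PhasePortrait.Conditions S Φ) {n m : ℕ} (hm : 0 < m)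
    {ybar tbar : ℝ} (hybar : (ybar, tbar) ∈ Φ.sectionP) (halpha : S.alpha ybar = n * S.T / m)
    {q : ℝ → Plane} (hq : S.IsSolution0 q) (hq0 : q 0 = (0, ybar))
    (hzero : S.melnikov q n tbar = 0) (hsimple : deriv (S.melnikov q n) tbar ≠ 0) :
    ∃ ψ : ℝ × ℝ → ℝ × ℝ, StrictlyDifferentiableAt ψ (0, 0) ∧ ψ (0, 0) = (ybar, tbar) ∧
      ∀ᶠ x in 𝓝 ((0 : ℝ), (0 : ℝ)),
        S.SolvesDissipative Φ n m x.1 (1 - x.1 * x.2) (ψ x) ∧ (x.1 = 0 → (ψ x).1 = ybar) := by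
  obtain ⟨τ, hτd, hτ⟩ := hΦ.exists_period
  obtain ⟨Q, s, hQ, hosc, hne, hper⟩ := hτ _ hybar
  simp only at hosc hper
  have hm' : (m : ℝ) ≠ 0 := by exact_mod_cast hm.ne'
  have hnm : m * τ (ybar ^ 2 / 2) = n * S.T := by
    rw [← hosc.alpha_eq hΦ.Vp_zero hΦ.Vm_zero, halpha]
    field_simp
  have hqQ : ∀ t, 0 ≤ t → q t = Q t := fun t ht =>
    (hQ.eq_of_eq hq (by rw [hq0, hosc.zero_eq]) hne t ht).symm
  have hy0 : 0 < ybar := hybar.1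
  obtain ⟨G, hGd, hG1, hG2, hGev⟩ := exists_iterateGerm (y₀ := ybar) (t₀ := tbar) hτ hybar.2 hosc m
  -- The substitution `1 - r = ε κ`: the energy balance acquires a common factor `ε`.
  set pt : (ℝ × ℝ) × (ℝ × ℝ) → ℝ × ℝ × ℝ × ℝ :=
    fun v => (v.2.1, v.2.2, v.1.1, v.1.1 * v.1.2) with hpt
  set b : (ℝ × ℝ) × (ℝ × ℝ) := ((0, 0), (ybar, tbar)) with hb
  have hptb : pt b = (ybar, tbar, 0, 0) := by simp [hpt, hb]
  have hptd : StrictlyDifferentiableAt pt b := .of_contDiff (by simp only [hpt]; fun_prop)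
  have hptc : Tendsto pt (𝓝 b) (𝓝 (ybar, tbar, 0, 0)) := by
    rw [← hptb]; exact hptd.continuousAt
  have hGptd : StrictlyDifferentiableAt (fun v => G (pt v)) b :=
    StrictlyDifferentiableAt.comp (by rw [hptb]; exact hGd) hptd
  -- The time equation, and the energy equation with its factor `ε` removed.
  set F : (ℝ × ℝ) × (ℝ × ℝ) → ℝ × ℝ := fun v =>
    ((G (pt v)).2.1 - v.2.2 - n * S.T, (G (pt v)).2.2.1 + v.1.2 * (G (pt v)).2.2.2) with hF
  have hFd : StrictlyDifferentiableAt F b :=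
    StrictlyDifferentiableAt.comp
      (g := fun r : (ℝ × ℝ × ℝ × ℝ) × ((ℝ × ℝ) × (ℝ × ℝ)) =>
        (r.1.2.1 - r.2.2.2 - n * S.T, r.1.2.2.1 + r.2.1.2 * r.1.2.2.2))
      (.of_contDiff (by fun_prop)) (hGptd.prodMk (.of_contDiff contDiff_id))
  have hFev := hptc.eventually hGev
  have hFy : ∀ᶠ y in 𝓝 ybar, (F ((0, 0), (y, tbar))).1 = m * τ (y ^ 2 / 2) - n * S.T := by
    have hc : Tendsto (fun y : ℝ => (((0 : ℝ), (0 : ℝ)), (y, tbar))) (𝓝 ybar) (𝓝 b) :=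
      Continuous.tendsto (by fun_prop) ybar
    filter_upwards [hc.eventually hFev] with y hy
    have h : (G (pt ((0, 0), (y, tbar)))).2.1 = tbar + m * τ (y ^ 2 / 2) :=
      (hy.2.2 rfl (by simp [hpt])).2.1
    change (G (pt ((0, 0), (y, tbar)))).2.1 - tbar - n * S.T = _
    rw [h]
    ring
  have hFt : ∀ᶠ t in 𝓝 tbar, F ((0, 0), (ybar, t)) = (0, S.melnikov q n t) := by
    have hc : Tendsto (fun t : ℝ => (((0 : ℝ), (0 : ℝ)), (ybar, t))) (𝓝 tbar) (𝓝 b) :=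
      Continuous.tendsto (by fun_prop) tbar
    filter_upwards [hc.eventually hFev] with t ht
    obtain ⟨-, h1, h2⟩ := ht.2.2 rfl (by simp [hpt])
    have h3 := h2 rfl
    rw [sum_integral_eq_melnikov hosc hper hqQ hnm] at h3
    simp only [hF, h1, h3]
    simp only [hpt, hnm]
    ext <;> simp
  have hFb : F b = 0 := by
    rw [hb, hFt.self_of_nhds, hzero]
    rfl
  have hc := energy_of_sectionP hybar
  have hτ' : HasDerivAt (fun y : ℝ => τ (y ^ 2 / 2)) (deriv τ (ybar ^ 2 / 2) * ybar) ybar := by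
    -- `deriv` is zero where there is no derivative, so its positivity already contains
    -- differentiability.
    have h1 : HasDerivAt τ (deriv τ (ybar ^ 2 / 2)) (ybar ^ 2 / 2) :=
      (differentiableAt_of_deriv_ne_zero (hτd _ hc).ne').hasDerivAt
    have h2 : HasDerivAt (fun y : ℝ => y ^ 2 / 2) ybar ybar := by
      have := (hasDerivAt_pow 2 ybar).div_const 2
      simpa using this
    exact h1.comp ybar h2
  have hτne : deriv τ (ybar ^ 2 / 2) * ybar ≠ 0 := mul_ne_zero (hτd _ hc).ne' hy0.ne'
  obtain ⟨ψ, hψd, hψ0, hψ⟩ := hFd.exists_implicit_branch (x₀ := (0, 0)) (u₀ := (ybar, tbar)) hFb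
    (mul_ne_zero hm' hτne) hsimple (((hτ'.const_mul (m : ℝ)).sub_const _).congr_of_eventuallyEq hFy)
    (((hasDerivAt_const _ (0 : ℝ)).prodMk
      (differentiableAt_of_deriv_ne_zero hsimple).hasDerivAt).congr_of_eventuallyEq hFt)
  refine ⟨ψ, hψd, hψ0, ?_⟩
  have hψc : Tendsto ψ (𝓝 (0, 0)) (𝓝 (ybar, tbar)) := by
    rw [← hψ0]; exact hψd.continuousAt
  have hψc' : Tendsto (fun x => (x, ψ x)) (𝓝 (0, 0)) (𝓝 b) := tendsto_id.prodMk_nhds hψc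
  have hpos : ∀ᶠ v in 𝓝 b, 0 < (G (pt v)).1 := by
    refine hGptd.continuousAt.fst.eventually (lt_mem_nhds ?_)
    simp only [hptb, hG1, hy0]
  have hpos' : ∀ᶠ u in 𝓝 (ybar, tbar), 0 < u.1 :=
    continuous_fst.continuousAt.eventually (lt_mem_nhds hy0)
  have hinj : ∀ᶠ y in 𝓝 ybar, τ (y ^ 2 / 2) = τ (ybar ^ 2 / 2) → y = ybar := by
    filter_upwards [eventually_nhdsWithin_iff.1 (hτ'.eventually_ne hτne)] with y hy h
    by_contra hne
    exact hy hne h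
  have hψ1 : Tendsto (fun x => (ψ x).1) (𝓝 (0, 0)) (𝓝 ybar) :=
    (continuous_fst.tendsto (ybar, tbar)).comp hψc
  filter_upwards [hψ, hψc'.eventually hFev, hψc'.eventually hpos, hψc.eventually hpos',
    hψ1.eventually hinj] with x hx hG hp hp' hi
  obtain ⟨hx1, hx2⟩ := Prod.ext_iff.1 hx
  obtain ⟨g1, g2, g3⟩ := hG
  simp only [hF, Prod.fst_zero, Prod.snd_zero] at hx1 hx2
  simp only [hpt] at g1 g2 g3 hx1 hx2 hp
  refine ⟨?_, fun hε => ?_⟩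
  -- The vanishing of `A + κ B` gives equal kinetic energies, hence equal velocities as both are
  -- positive.
  · have hE : (G ((ψ x).1, (ψ x).2, x.1, x.1 * x.2)).1 = (ψ x).1 := by
      refine (sq_eq_sq₀ hp.le hp'.le).1 ?_
      linear_combination 2 * g2 + 2 * x.1 * hx2
    rw [hE, show (G ((ψ x).1, (ψ x).2, x.1, x.1 * x.2)).2.1 = (ψ x).2 + n * S.T by linarith] at g1
    exact g1
  -- At `ε = 0` also `1 - r = ε κ` vanishes, so for every `κ` the time equation is the unperturbed
  -- one and local injectivity of the period fixes `y`.
  · have h1 := (g3 hε (by simp [hε])).2.1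
    refine hi (mul_left_cancel₀ hm' ?_)
    linarith

end PiecewiseHamiltonian

/-! ### Reading the two limits off the branch -/

theorem theorem2 (S : PiecewiseHamiltonian) (Φ : PiecewiseHamiltonian.PhasePortrait)
    (hΦ : PiecewiseHamiltonian.PhasePortrait.Conditions S Φ)
    (n m : ℕ) (hm : 0 < m) (hnm : Nat.Coprime n m)
    (ybar tbar : ℝ) (hybar : (ybar, tbar) ∈ Φ.sectionP)
    (halpha : S.alpha ybar = n * S.T / m)
    (q : ℝ → Plane) (hq : S.IsSolution0 q) (hq0 : q 0 = (0, ybar))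
    (hzero : S.melnikov q n tbar = 0) (hsimple : deriv (S.melnikov q n) tbar ≠ 0) :
    ∃ ρ > (0 : ℝ), ∃ K : ℝ, ∃ ystar tstar : ℝ → ℝ → ℝ,
      (∀ ε' r' : ℝ, 0 < ε' → 0 < r' → r' / ε' < ρ →
        ∃ δ₀ > (0 : ℝ), ∃ C that : ℝ, |that - tbar| ≤ K * (r' / ε') ∧
          ∀ δ : ℝ, 0 < δ → δ < δ₀ →
            S.SolvesDissipative Φ n m (ε' * δ) (1 - r' * δ)
              (ystar (ε' * δ) (1 - r' * δ), tstar (ε' * δ) (1 - r' * δ)) ∧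
            |ystar (ε' * δ) (1 - r' * δ) - ybar| ≤ C * δ ∧
            |tstar (ε' * δ) (1 - r' * δ) - that| ≤ C * δ) ∧
      (∃ ε₀ > (0 : ℝ), ∃ C : ℝ, ∃ ycons tcons : ℝ → ℝ, ∀ ε : ℝ, 0 < ε → ε < ε₀ →
        S.SolvesConservative Φ n m ε (ycons ε, tcons ε) ∧
        |ycons ε - ybar| ≤ C * ε ∧ |tcons ε - tbar| ≤ C * ε ∧
        (∀ᶠ r in 𝓝[<] (1 : ℝ), S.SolvesDissipative Φ n m ε r (ystar ε r, tstar ε r)) ∧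
        Tendsto (fun r => (ystar ε r, tstar ε r)) (𝓝[<] 1) (𝓝 (ycons ε, tcons ε))) := by
  obtain ⟨ψ, ⟨L, hL⟩, hψ0, hψ⟩ := PiecewiseHamiltonian.exists_branch hΦ hm hybar halpha hq hq0
    hzero hsimple
  -- A strict derivative at the origin gives a Lipschitz bound on a whole neighbourhood, hence also
  -- continuity at the points `(ε, 0)`, needed for the limit `r → 1`.
  obtain ⟨K, U, hU, hK⟩ := hL.exists_lipschitzOnWith
  obtain ⟨ρ, hρ, hball⟩ := Metric.eventually_nhds_iff.1 (hψ.and hU)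
  have hmem : ∀ {x : ℝ × ℝ}, |x.1| < ρ → |x.2| < ρ →
      (S.SolvesDissipative Φ n m x.1 (1 - x.1 * x.2) (ψ x) ∧ (x.1 = 0 → (ψ x).1 = ybar)) ∧
        x ∈ U := fun {x} h1 h2 => hball (by
    rw [Prod.dist_eq, Real.dist_0_eq_abs, Real.dist_0_eq_abs]
    exact max_lt h1 h2)
  have hlip : ∀ {x x' : ℝ × ℝ} {d : ℝ}, x ∈ U → x' ∈ U → |x.1 - x'.1| ≤ d → |x.2 - x'.2| ≤ d →
      |(ψ x).1 - (ψ x').1| ≤ K * d ∧ |(ψ x).2 - (ψ x').2| ≤ K * d := by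
    intro x x' d hx hx' h1 h2
    have h := (hK.dist_le_mul x hx x' hx').trans
      (mul_le_mul_of_nonneg_left (show dist x x' ≤ d by
        rw [Prod.dist_eq]; exact max_le h1 h2) K.coe_nonneg)
    rw [Prod.dist_eq] at h
    exact ⟨(le_max_left _ _).trans h, (le_max_right _ _).trans h⟩
  have hρ0 : |(0 : ℝ)| < ρ := by simpa using hρ
  refine ⟨ρ, hρ, K, fun ε r => (ψ (ε, (1 - r) / ε)).1, fun ε r => (ψ (ε, (1 - r) / ε)).2, ?_,
    ρ, hρ, K, fun ε => (ψ (ε, 0)).1, fun ε => (ψ (ε, 0)).2, fun ε hε hερ => ?_⟩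
  · intro ε' r' hε' hr' hκ
    have hκ0 : 0 < r' / ε' := div_pos hr' hε'
    have hκ' : |r' / ε'| < ρ := by rwa [abs_of_pos hκ0]
    obtain ⟨⟨-, hy⟩, hxU⟩ := hmem (x := (0, r' / ε')) hρ0 hκ'
    have h0U : ((0 : ℝ), (0 : ℝ)) ∈ U := (hmem (x := (0, 0)) hρ0 hρ0).2
    -- Along the ray, `κ = r' / ε'` does not depend on `δ`. The comparison point is `(0, κ)`, at
    -- distance `ε' * δ`, whence the constant; the bound on `δ` keeps `ε' * δ < ρ`.
    refine ⟨ρ / ε', div_pos hρ hε', K * ε', (ψ (0, r' / ε')).2, ?_, fun δ hδ hδ₀ => ?_⟩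
    · have := (hlip hxU h0U (d := r' / ε') (by simpa using hκ0.le)
        (by simp [abs_of_pos hκ0])).2
      rwa [hψ0] at this
    · have hr : (1 - (1 - r' * δ)) / (ε' * δ) = r' / ε' := by field_simp; ring
      have hδρ : ε' * δ < ρ := by rwa [lt_div_iff₀' hε'] at hδ₀
      have hpos : 0 < ε' * δ := mul_pos hε' hδ
      obtain ⟨⟨hsol, -⟩, hU'⟩ := hmem (x := (ε' * δ, r' / ε')) (by rwa [abs_of_pos hpos]) hκ'
      have h := hlip hU' hxU (d := ε' * δ) (by simp [abs_of_pos hpos]) (by simpa using hpos.le)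
      simp only [hr, mul_assoc]
      rw [hy rfl] at h
      refine ⟨?_, h⟩
      simpa only [show 1 - ε' * δ * (r' / ε') = 1 - r' * δ by field_simp] using hsol
  · have hεa : |ε| < ρ := by rwa [abs_of_pos hε]
    obtain ⟨⟨hsol, -⟩, hU'⟩ := hmem (x := (ε, 0)) hεa hρ0
    have h0U : ((0 : ℝ), (0 : ℝ)) ∈ U := (hmem (x := (0, 0)) hρ0 hρ0).2
    have h := hlip hU' h0U (d := ε) (by simp [abs_of_pos hε]) (by simpa using hε.le)
    rw [hψ0] at h
    have hκ : Tendsto (fun r : ℝ => (ε, (1 - r) / ε)) (𝓝[<] 1) (𝓝 (ε, 0)) := by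
      have : Continuous fun r : ℝ => (ε, (1 - r) / ε) := by fun_prop
      simpa using (this.tendsto 1).mono_left nhdsWithin_le_nhds
    have hnear : ∀ᶠ x in 𝓝 (ε, (0 : ℝ)), |x.1| < ρ ∧ |x.2| < ρ :=
      (continuous_fst.abs.continuousAt.eventually (gt_mem_nhds hεa)).and
        (continuous_snd.abs.continuousAt.eventually (gt_mem_nhds hρ0))
    refine ⟨?_, h.1, h.2, ?_, ?_⟩
    · simp only [mul_zero, sub_zero] at hsol
      exact hsol.solvesConservative
    · filter_upwards [hκ.eventually hnear] with r hr
      have := (hmem (x := (ε, (1 - r) / ε)) hr.1 hr.2).1.1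
      simpa only [show 1 - ε * ((1 - r) / ε) = r by field_simp; ring] using this
    · have hUn : U ∈ 𝓝 (ε, (0 : ℝ)) := by
        filter_upwards [hnear] with x hx using (hmem hx.1 hx.2).2
      exact (hK.continuousOn.continuousAt hUn).tendsto.comp hκ
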